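/- Let $m\ge 1$ be an integer and let $\Gamma=\mathbb{Z}_m\wr\mathbb{Z}$ be the lamplighter group: its elements are the pairs $(\varphi,x)$ with $\varphi:\mathbb{Z}\to\mathbb{Z}_m$ finitely supported and $x\in\mathbb{Z}$, with product $(\varphi_1,x_1)(\varphi_2,x_2)=(\varphi_1+\varphi_2(\cdot-x_1),\,x_1+x_2)$. Let $S$ be any finite symmetric generating set of $\Gamma$ not containing the unit element $\iota$, let $k=|S|$, and let $G$ be the ($k$-regular) Cayley graph with vertex set $\Gamma$ and edges joining $x$ and $xs$, $x\in\Gamma$, $s\in S$. For $0<p<1$ consider independent site or bond percolation on $G$ with parameter $p$: every vertex (respectively edge) is open with probability $p$ and closed with probability $1-p$, independently. For a configuration $\omega$ let $G(\omega)$ be the subgraph of $G$ induced by the set $V(\omega)$ of open vertices (site percolation), respectively the subgraph whose edges are the open edges and whose vertex set $V(\omega)$ consists of the end points of open edges (bond percolation). Let $A_\omega$ and $D_\omega$ be the adjacency operator and the degree operator of $G(\omega)$ on $\ell^2(V(\omega))$, and let $$\Delta^A_\omega=k\,\mathrm{Id}-A_\omega,\qquad \Delta^D_\omega=2k\,\mathrm{Id}-D_\omega-A_\omega$$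 be the adjacency and the Dirichlet percolation Laplacian, with integrated densities of states $$N^{\#}(E)=\mathbb{E}\,\big\langle\chi_{(-\infty,E]}(\Delta^{\#}_\omega)\,\delta_\iota,\delta_\iota\big\rangle,\qquad \#\in\{A,D\},$$ where the scalar product is read as $0$ if $\iota\notin V(\omega)$. Theorem. The natural set $$S_0=\{(l\,\delta_1,1): l\in\mathbb{Z}_m\}\cup\{(l\,\delta_0,-1): l\in\mathbb{Z}_m\}$$ is such a generating set (here $l\,\delta_z$ takes the value $l$ at $z$ and $0$ elsewhere). For every such generating set $S$ (in particular for $S=S_0$), for site and for bond percolation, and for every $0<p<1$, there are constants $c_1,c_2>0$, which may depend on $m$, $S$, $p$ and the percolation model, such that for all sufficiently small $E>0$ $$\exp\!\big(-c_1\exp(c_2E^{-1/2})\big)\le N^D(E)\le N^A(E).$$ -/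

import Mathlib

open scoped Topology lp

/-! ### The lamplighter group `ℤ_m ≀ ℤ` -/

/-- Elements `(φ, x)` of the lamplighter group: a finitely supported lamp configuration
`φ : ℤ → ℤ_m` and a position `x : ℤ`. -/
@[ext]
structure Lamplighter (m : ℕ) where
  lamps : ℤ →₀ ZMod m
  pos : ℤ

namespace Lamplighter

/-- The translated configuration `φ(· - x)`. -/
noncomputable def shift {m : ℕ} (x : ℤ) (φ : ℤ →₀ ZMod m) : ℤ →₀ ZMod m :=
  Finsupp.equivMapDomain (Equiv.addRight x) φ

@[simp]
theorem shift_apply {m : ℕ} (x : ℤ) (φ : ℤ →₀ ZMod m) (z : ℤ) : shift x φ z = φ (z - x) := by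
  simp [shift, sub_eq_add_neg]

/-- `(φ₁, x₁) * (φ₂, x₂) = (φ₁ + φ₂(· - x₁), x₁ + x₂)`. -/
noncomputable instance (m : ℕ) : Mul (Lamplighter m) :=
  ⟨fun a b => ⟨a.lamps + shift a.pos b.lamps, a.pos + b.pos⟩⟩

noncomputable instance (m : ℕ) : One (Lamplighter m) := ⟨⟨0, 0⟩⟩

noncomputable instance (m : ℕ) : Inv (Lamplighter m) :=
  ⟨fun a => ⟨-shift (-a.pos) a.lamps, -a.pos⟩⟩

@[simp]
theorem mul_lamps {m : ℕ} (a b : Lamplighter m) :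
    (a * b).lamps = a.lamps + shift a.pos b.lamps := rfl

@[simp]
theorem mul_pos {m : ℕ} (a b : Lamplighter m) : (a * b).pos = a.pos + b.pos := rfl

@[simp]
theorem one_lamps {m : ℕ} : (1 : Lamplighter m).lamps = 0 := rfl

@[simp]
theorem one_pos {m : ℕ} : (1 : Lamplighter m).pos = 0 := rfl

@[simp]
theorem inv_lamps {m : ℕ} (a : Lamplighter m) : (a⁻¹).lamps = -shift (-a.pos) a.lamps := rfl

@[simp]
theorem inv_pos {m : ℕ} (a : Lamplighter m) : (a⁻¹).pos = -a.pos := rfl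

noncomputable instance (m : ℕ) : Group (Lamplighter m) :=
  Group.ofLeftAxioms
    (fun a b c => by
      ext z
      · simp [add_assoc, sub_sub]
      · simp [add_assoc])
    (fun a => by
      ext z <;> simp)
    (fun a => by
      ext z <;> simp)

open Classical in
/-- The natural generators `(l·δ₁, 1)` and `(l·δ₀, -1)`, `l ∈ ℤ_m`. -/
noncomputable def naturalGenerators (m : ℕ) [NeZero m] : Finset (Lamplighter m) :=
  (Finset.univ.image fun l : ZMod m => (⟨Finsupp.single 1 l, 1⟩ : Lamplighter m)) ∪
    (Finset.univ.image fun l : ZMod m => (⟨Finsupp.single 0 l, -1⟩ : Lamplighter m))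

end Lamplighter

/-! ### Adjacency and degree operators of a graph of bounded degree -/

namespace SimpleGraph

/-- The vertex degrees of `H` are uniformly bounded. -/
class BoundedDegree {V : Type*} (H : SimpleGraph V) : Prop where
  exists_bound : ∃ K : ℕ, ∀ x, (H.neighborSet x).encard ≤ K

theorem finite_neighborSet {V : Type*} (H : SimpleGraph V) [hH : BoundedDegree H] (x : V) :
    (H.neighborSet x).Finite := by
  obtain ⟨K, hK⟩ := hH.exists_bound
  exact Set.finite_of_encard_le_coe (hK x)

/-- The degree of `x` in `H`. -/
noncomputable def deg {V : Type*} (H : SimpleGraph V) (x : V) : ℕ := (H.neighborSet x).ncard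

/-- `(A φ)(x) = ∑_{y ∼ x} φ(y)`. -/
noncomputable def adjFun {V : Type*} (H : SimpleGraph V) [BoundedDegree H] (φ : V → ℂ) (x : V) :
    ℂ :=
  ∑ y ∈ (H.finite_neighborSet x).toFinset, φ y

theorem exists_deg_bound {V : Type*} (H : SimpleGraph V) [hH : BoundedDegree H] :
    ∃ K : ℕ, ∀ x, H.deg x ≤ K := by
  obtain ⟨K, hK⟩ := hH.exists_bound
  refine ⟨K, fun x => ?_⟩
  have h := hK x
  rw [← (H.finite_neighborSet x).cast_ncard_eq] at h
  exact_mod_cast h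

theorem sum_norm_adjFun_sq_le {V : Type*} (H : SimpleGraph V) [BoundedDegree H] {K : ℕ}
    (hK : ∀ x, H.deg x ≤ K) (φ : ℓ²(V, ℂ)) (F : Finset V) :
    ∑ x ∈ F, ‖H.adjFun φ x‖ ^ 2 ≤ ((K : ℝ) * ‖φ‖) ^ 2 := by
  classical
  set N : V → Finset V := fun x => (H.finite_neighborSet x).toFinset with hN
  have hcard : ∀ x, ((N x).card : ℝ) ≤ K := fun x => by
    have := hK x
    rw [deg, Set.ncard_eq_toFinset_card _ (H.finite_neighborSet x)] at this
    exact_mod_cast this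
  have hmem : ∀ x y, y ∈ N x ↔ H.Adj x y := fun x y => by simp [hN]
  have h1 : ∀ x ∈ F, ‖H.adjFun φ x‖ ^ 2 ≤ K * ∑ y ∈ N x, ‖φ y‖ ^ 2 := fun x _ => by
    calc ‖H.adjFun φ x‖ ^ 2 ≤ (∑ y ∈ N x, ‖φ y‖) ^ 2 := by
          gcongr
          exact norm_sum_le _ _
      _ ≤ (N x).card * ∑ y ∈ N x, ‖φ y‖ ^ 2 := sq_sum_le_card_mul_sum_sq
      _ ≤ K * ∑ y ∈ N x, ‖φ y‖ ^ 2 := by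
          gcongr
          exact_mod_cast hcard x
  have h2 : ∑ x ∈ F, ∑ y ∈ N x, ‖φ y‖ ^ 2 ≤ K * ∑ y ∈ F.biUnion N, ‖φ y‖ ^ 2 := by
    rw [Finset.sum_comm' (s' := fun y => (N y).filter (· ∈ F)) (t' := F.biUnion N)
      (fun x y => by
        simp only [hmem, Finset.mem_filter, Finset.mem_biUnion, H.adj_comm y x]
        constructor
        · rintro ⟨hx, hxy⟩
          exact ⟨⟨hxy, hx⟩, x, hx, hxy⟩
        · rintro ⟨⟨hxy, hx⟩, -⟩
          exact ⟨hx, hxy⟩), Finset.mul_sum]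
    refine Finset.sum_le_sum fun y _ => ?_
    rw [Finset.sum_const, nsmul_eq_mul]
    have h3 : (((N y).filter (· ∈ F)).card : ℝ) ≤ (N y).card := by
      exact_mod_cast Finset.card_filter_le _ _
    exact mul_le_mul_of_nonneg_right (h3.trans (hcard y)) (by positivity)
  have h4 : ∑ y ∈ F.biUnion N, ‖φ y‖ ^ 2 ≤ ‖φ‖ ^ 2 := by
    have := lp.sum_rpow_le_norm_rpow (p := 2) (by norm_num) φ (F.biUnion N)
    simpa using this
  calc ∑ x ∈ F, ‖H.adjFun φ x‖ ^ 2 ≤ ∑ x ∈ F, K * ∑ y ∈ N x, ‖φ y‖ ^ 2 := Finset.sum_le_sum h1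
    _ = K * ∑ x ∈ F, ∑ y ∈ N x, ‖φ y‖ ^ 2 := by rw [Finset.mul_sum]
    _ ≤ K * (K * ‖φ‖ ^ 2) := by gcongr; exact h2.trans (by gcongr)
    _ = ((K : ℝ) * ‖φ‖) ^ 2 := by ring

theorem memℓp_adjFun {V : Type*} (H : SimpleGraph V) [BoundedDegree H] (φ : ℓ²(V, ℂ)) :
    Memℓp (H.adjFun φ) 2 := by
  obtain ⟨K, hK⟩ := H.exists_deg_bound
  refine memℓp_gen' (C := ((K : ℝ) * ‖φ‖) ^ 2) fun F => ?_
  simpa using H.sum_norm_adjFun_sq_le hK φ F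

/-- The adjacency operator on `ℓ²(V)`: `(A φ)(x) = ∑_{y ∼ x} φ(y)`. -/
noncomputable def adjacencyOperator {V : Type*} (H : SimpleGraph V) [BoundedDegree H] :
    ℓ²(V, ℂ) →L[ℂ] ℓ²(V, ℂ) :=
  LinearMap.mkContinuousOfExistsBound
    { toFun := fun φ => ⟨H.adjFun φ, H.memℓp_adjFun φ⟩
      map_add' := fun φ ψ => by
        ext x
        exact Finset.sum_add_distrib
      map_smul' := fun c φ => by
        ext x
        simp [adjFun, Finset.mul_sum] }
    (by
      obtain ⟨K, hK⟩ := H.exists_deg_bound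
      refine ⟨K, fun φ => lp.norm_le_of_forall_sum_le (p := 2) (by norm_num) (by positivity) ?_⟩
      intro F
      simpa using H.sum_norm_adjFun_sq_le hK φ F)

theorem sum_norm_deg_mul_sq_le {V : Type*} (H : SimpleGraph V) {K : ℕ}
    (hK : ∀ x, H.deg x ≤ K) (φ : ℓ²(V, ℂ)) (F : Finset V) :
    ∑ x ∈ F, ‖(H.deg x : ℂ) * φ x‖ ^ 2 ≤ ((K : ℝ) * ‖φ‖) ^ 2 := by
  have h4 : ∑ y ∈ F, ‖φ y‖ ^ 2 ≤ ‖φ‖ ^ 2 := by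
    have := lp.sum_rpow_le_norm_rpow (p := 2) (by norm_num) φ F
    simpa using this
  calc ∑ x ∈ F, ‖(H.deg x : ℂ) * φ x‖ ^ 2 ≤ ∑ x ∈ F, (K : ℝ) ^ 2 * ‖φ x‖ ^ 2 := by
        refine Finset.sum_le_sum fun x _ => ?_
        rw [norm_mul, mul_pow, Complex.norm_natCast]
        have : (H.deg x : ℝ) ≤ K := by exact_mod_cast hK x
        gcongr
    _ = (K : ℝ) ^ 2 * ∑ x ∈ F, ‖φ x‖ ^ 2 := by rw [Finset.mul_sum]
    _ ≤ (K : ℝ) ^ 2 * ‖φ‖ ^ 2 := by gcongr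
    _ = ((K : ℝ) * ‖φ‖) ^ 2 := by ring

theorem memℓp_deg_mul {V : Type*} (H : SimpleGraph V) [BoundedDegree H] (φ : ℓ²(V, ℂ)) :
    Memℓp (fun x => (H.deg x : ℂ) * φ x) 2 := by
  obtain ⟨K, hK⟩ := H.exists_deg_bound
  refine memℓp_gen' (C := ((K : ℝ) * ‖φ‖) ^ 2) fun F => ?_
  simpa using H.sum_norm_deg_mul_sq_le hK φ F

/-- The degree operator on `ℓ²(V)`: `(D φ)(x) = deg(x) φ(x)`. -/
noncomputable def degreeOperator {V : Type*} (H : SimpleGraph V) [BoundedDegree H] :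
    ℓ²(V, ℂ) →L[ℂ] ℓ²(V, ℂ) :=
  LinearMap.mkContinuousOfExistsBound
    { toFun := fun φ => ⟨fun x => (H.deg x : ℂ) * φ x, H.memℓp_deg_mul φ⟩
      map_add' := fun φ ψ => by
        ext x
        exact mul_add _ _ _
      map_smul' := fun c φ => by
        ext x
        simp [mul_left_comm] }
    (by
      obtain ⟨K, hK⟩ := H.exists_deg_bound
      refine ⟨K, fun φ => lp.norm_le_of_forall_sum_le (p := 2) (by norm_num) (by positivity) ?_⟩
      intro F
      simpa using H.sum_norm_deg_mul_sq_le hK φ F)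

/-- A subgraph of a graph of bounded degree has bounded degree. -/
instance boundedDegree_coe {V : Type*} (G : SimpleGraph V) [hG : BoundedDegree G]
    (G' : G.Subgraph) : BoundedDegree G'.coe := by
  obtain ⟨K, hK⟩ := hG.exists_bound
  refine ⟨K, fun x => le_trans ?_ (hK x)⟩
  rw [← (Subtype.val_injective).encard_image]
  refine Set.encard_le_encard ?_
  rintro _ ⟨y, hy, rfl⟩
  exact G'.adj_sub hy

/-- The Cayley graph of a group with respect to a finite set `S`: the edges join `x` and `x s`. -/
abbrev cayleyGraph {Γ : Type*} [Group Γ] (S : Finset Γ) : SimpleGraph Γ :=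
  SimpleGraph.mulCayley (S : Set Γ)

instance boundedDegree_cayleyGraph {Γ : Type*} [Group Γ] (S : Finset Γ) :
    BoundedDegree (cayleyGraph S) := by
  classical
  refine ⟨(S ∪ S.image (·⁻¹)).card, fun x => ?_⟩
  have hsub : (cayleyGraph S).neighborSet x ⊆
      ((S ∪ S.image (·⁻¹)).image (x * ·) : Finset Γ) := by
    intro y hy
    obtain ⟨-, g, hg, h | h⟩ := (SimpleGraph.mulCayley_adj' _ _ _).1 hy
    · simp only [Finset.coe_image, Set.mem_image, Finset.mem_coe, Finset.mem_union]
      exact ⟨g, Or.inl hg, h⟩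
    · simp only [Finset.coe_image, Set.mem_image, Finset.mem_coe, Finset.mem_union]
      exact ⟨g⁻¹, Or.inr (Finset.mem_image_of_mem _ hg), by rw [h]; simp⟩
  refine (Set.encard_le_encard hsub).trans ?_
  rw [Set.encard_coe_eq_coe_finsetCard]
  exact_mod_cast Finset.card_image_le

end SimpleGraph

/-! ### Spectral projections of bounded self-adjoint operators -/

/-- For bounded self-adjoint `T`, the spectral projection `χ_{(-∞, E]}(T)`. The continuous function
`f(t) = max (t - E) 0` vanishes exactly on `(-∞, E]`, and the kernel of `f(T)` is the range of
`χ_{f = 0}(T)`; so the spectral projection is the orthogonal projection onto the kernel of the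
positive part `(T - E)₊`. -/
noncomputable def spectralProjection {H : Type*} [NormedAddCommGroup H] [InnerProductSpace ℂ H]
    [CompleteSpace H] (T : H →L[ℂ] H) (E : ℝ) : H →L[ℂ] H :=
  (LinearMap.ker (cfc (fun t : ℝ => max (t - E) 0) T).toLinearMap).starProjection

/-! ### Percolation on Cayley graphs -/

namespace Percolation

open MeasureTheory ProbabilityTheory SimpleGraph

/-- The two percolation processes: deletion of vertices and deletion of edges. -/
inductive Model
  | site
  | bond

/-- The two boundary conditions: the adjacency Laplacian and the Dirichlet Laplacian. -/
inductive BoundaryCondition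
  | adjacency
  | dirichlet

/-- The adjacency Laplacian `k - A(G')` and the Dirichlet Laplacian `2k - D(G') - A(G')` of a
subgraph `G'` of a `k`-regular graph, acting on `ℓ²(V')`. -/
noncomputable def laplacian {V : Type*} {G : SimpleGraph V} [BoundedDegree G] (k : ℕ)
    (G' : G.Subgraph) : BoundaryCondition → (ℓ²(G'.verts, ℂ) →L[ℂ] ℓ²(G'.verts, ℂ))
  | .adjacency => (k : ℂ) • 1 - G'.coe.adjacencyOperator
  | .dirichlet => (2 * k : ℂ) • 1 - G'.coe.degreeOperator - G'.coe.adjacencyOperator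

/-- The vector `δ_x ∈ ℓ²(V')`; it is zero if `x` is not a vertex of `G'`. -/
noncomputable def delta {V : Type*} {G : SimpleGraph V} (G' : G.Subgraph) (x : V) :
    ℓ²(G'.verts, ℂ) :=
  open Classical in if h : x ∈ G'.verts then lp.single 2 (⟨x, h⟩ : G'.verts) (1 : ℂ) else 0

/-- The objects that are deleted or kept: vertices or edges. -/
def Index {V : Type*} (G : SimpleGraph V) : Model → Type _
  | .site => V
  | .bond => G.edgeSet

/-- A configuration says which vertices (edges) are open (`true`) and which are closed. -/
abbrev Config {V : Type*} (G : SimpleGraph V) (M : Model) : Type _ := Index G M → Bool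

/-- Independently, each vertex (edge) is open with probability `p`, closed with probability
`1 - p`. -/
noncomputable def law {V : Type*} (G : SimpleGraph V) (M : Model) (p : unitInterval) :
    Measure (Config G M) :=
  Measure.infinitePi fun _ => bernoulliMeasure true false p

/-- The percolation subgraph. Site percolation: the subgraph induced by the open vertices.
Bond percolation: its edges are the open edges, its vertices the end points of open edges. -/
def subgraph {V : Type*} (G : SimpleGraph V) : (M : Model) → Config G M → G.Subgraph
  | .site, ω => (⊤ : G.Subgraph).induce {x : V | ω x = true}
  | .bond, ω =>
    { verts := {x | ∃ y, ∃ h : G.Adj x y, ω (⟨s(x, y), h⟩ : G.edgeSet) = true}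
      Adj := fun x y => ∃ h : G.Adj x y, ω (⟨s(x, y), h⟩ : G.edgeSet) = true
      adj_sub := fun h => h.1
      edge_vert := fun {x y} h => ⟨y, h⟩
      symm := ⟨fun x y ⟨h, hω⟩ => ⟨h.symm, by
        have he : (⟨s(y, x), h.symm⟩ : G.edgeSet) = ⟨s(x, y), h⟩ := Subtype.ext Sym2.eq_swap
        rw [he]
        exact hω⟩⟩ }

/-- A finite symmetric generating set that does not contain the unit element. The Cayley graph is
then regular of degree `|S|`. -/
structure IsCayleyGenerators {Γ : Type*} [Group Γ] (S : Finset Γ) : Prop where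
  inv_mem : ∀ s ∈ S, s⁻¹ ∈ S
  one_notMem : (1 : Γ) ∉ S
  closure_eq_top : Subgroup.closure (S : Set Γ) = ⊤

/-- The integrated density of states
`N(E) = 𝔼 ⟨χ_{(-∞, E]}(Δ_ω) δ_1, δ_1⟩` of the percolation Laplacian on the Cayley graph with
respect to `S`, where `1` is the unit element of the group. -/
noncomputable def ids {Γ : Type*} [Group Γ] (S : Finset Γ) (M : Model) (p : unitInterval)
    (bc : BoundaryCondition) (E : ℝ) : ℝ :=
  ∫ ω, (inner ℂ
      (spectralProjection (laplacian S.card (subgraph (cayleyGraph S) M ω) bc) E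
        (delta (subgraph (cayleyGraph S) M ω) 1))
      (delta (subgraph (cayleyGraph S) M ω) 1)).re ∂(law (cayleyGraph S) M p)

end Percolation

/-!
# Lower bounds for the integrated density of states of percolation on the lamplighter group

*Comparison of the two densities of states.* Since `Δ^D - Δ^A = k - D ≥ 0`, no nonzero vector lies
both in the range of `χ_{(-∞, E]}(Δ^D)` and in the kernel of `χ_{(-∞, E]}(Δ^A)`
(`eq_zero_of_spectralProjection`). The expectation `𝔼 ⟨δ_1, T δ_1⟩` is a trace on equivariant random
operators by mass transport (`trace_mul_comm`), so that an equivariant contraction and its adjoint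
have kernels of the same trace (`trace_ker_eq_trace_ker_adjoint`). Applied to the product of the two
projections this gives `N^D ≤ N^A` (`ids_dirichlet_le_adjacency`). The operators live on the varying
spaces `ℓ²(V(ω))`; they are extended by zero to `ℓ²(Γ)`, where measurability and equivariance pass
from the Laplacian to its polynomials and, by the mean ergodic theorem, to its spectral projections
(`exists_polynomial_tendsto_spectralProjection`).

*The lower bound.* Let `f` be supported on a finite set `F` and have Rayleigh quotient at most
`E / 2` for the Laplacian of the full Cayley graph. With probability at least `p ^ ((k + 1) |F|)` all edges
that touch `F` are present; then `f` has the same quadratic form for `Δ^D`, and the spectral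
projection has trace at least `1 / 2` on `F` (`half_le_sum_entry`). By translation invariance
`N^D(E) ≥ p ^ ((k + 1) |F|) / (2 |F|)` (`le_ids_dirichlet`). In the lamplighter group, the tent
functions of the position, restricted to the configurations whose lamps are off outside an interval
slightly larger than the tent, have Rayleigh quotient `O(j⁻²)` (`rayleigh_tent`), where the height
is `2j`, and supports of size exponential in `j` (`card_tower_le_exp`); take `j ≈ E^{-1/2}`.
-/

/-! ### Spectral projections -/

section Spectral

theorem re_inner_self_eq_norm_sq {H : Type*} [NormedAddCommGroup H] [InnerProductSpace ℂ H]
    (v : H) : (inner ℂ v v).re = ‖v‖ ^ 2 := by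
  rw [inner_self_eq_norm_sq_to_K]
  exact_mod_cast Complex.ofReal_re _

variable {H : Type*} [NormedAddCommGroup H] [InnerProductSpace ℂ H] [CompleteSpace H]

theorem IsSelfAdjoint.inner_apply_comm {T : H →L[ℂ] H} (hT : IsSelfAdjoint T) (v w : H) :
    inner ℂ (T v) w = inner ℂ v (T w) := by
  rw [← ContinuousLinearMap.adjoint_inner_right, hT.adjoint_eq]

/-- The decomposition `T - E = s² - g` into positive and negative parts, `s² = (T - E)₊`. -/
theorem exists_pos_neg_part {T : H →L[ℂ] H} (hT : IsSelfAdjoint T) (E : ℝ) :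
    ∃ s g : H →L[ℂ] H, IsSelfAdjoint s ∧ IsSelfAdjoint g ∧
      cfc (fun t : ℝ => max (t - E) 0) T = s * s ∧
      (∀ v, T v = (E : ℂ) • v + (s * s) v - g v) ∧ s * s * g = 0 ∧
      (∀ v, 0 ≤ (inner ℂ (g v) v).re) := by
  have e1 : cfc (fun t : ℝ => max (t - E) 0) T =
      cfc (fun t : ℝ => √(max (t - E) 0)) T * cfc (fun t : ℝ => √(max (t - E) 0)) T := by
    rw [← cfc_mul (fun t : ℝ => √(max (t - E) 0)) (fun t : ℝ => √(max (t - E) 0)) T]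
    congr 1
    ext t
    rw [Real.mul_self_sqrt (le_max_right _ _)]
  have e2 : cfc (fun t : ℝ => max (E - t) 0) T =
      cfc (fun t : ℝ => √(max (E - t) 0)) T * cfc (fun t : ℝ => √(max (E - t) 0)) T := by
    rw [← cfc_mul (fun t : ℝ => √(max (E - t) 0)) (fun t : ℝ => √(max (E - t) 0)) T]
    congr 1
    ext t
    rw [Real.mul_self_sqrt (le_max_right _ _)]
  refine ⟨cfc (fun t : ℝ => √(max (t - E) 0)) T, cfc (fun t : ℝ => max (E - t) 0) T,
    cfc_predicate _ _, cfc_predicate _ _, e1, fun v => ?_, ?_, fun v => ?_⟩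
  · rw [← e1]
    have h : T = cfc (fun t : ℝ => E + max (t - E) 0 - max (E - t) 0) T := by
      conv_lhs => rw [← cfc_id' ℝ T]
      congr 1
      ext t
      rcases le_total t E with h | h
      · rw [max_eq_right (by linarith), max_eq_left (by linarith)]; ring
      · rw [max_eq_left (by linarith), max_eq_right (by linarith)]; ring
    rw [cfc_sub (fun t : ℝ => E + max (t - E) 0) (fun t => max (E - t) 0) T,
      cfc_add T (fun _ : ℝ => E) (fun t : ℝ => max (t - E) 0), cfc_const E T] at h
    conv_lhs => rw [h]
    simp [Algebra.algebraMap_eq_smul_one]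
  · rw [← e1, ← cfc_mul (fun t : ℝ => max (t - E) 0) (fun t => max (E - t) 0) T]
    convert cfc_const_zero ℝ T using 2
    ext t
    rcases le_total t E with h | h
    · rw [max_eq_right (by linarith), zero_mul]
    · rw [max_eq_right (a := E - t) (by linarith), mul_zero]
  · have hs : IsSelfAdjoint (cfc (fun t : ℝ => √(max (E - t) 0)) T) := cfc_predicate _ _
    rw [e2, mul_apply_eq_comp, hs.inner_apply_comm, re_inner_self_eq_norm_sq]
    positivity

theorem spectralProjection_apply_mem (T : H →L[ℂ] H) (E : ℝ) (v : H) :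
    cfc (fun t : ℝ => max (t - E) 0) T (spectralProjection T E v) = 0 :=
  (Submodule.starProjection_apply_mem
    (LinearMap.ker (cfc (fun t : ℝ => max (t - E) 0) T).toLinearMap) v :)

/-- If `A ≤ B`, the range of `χ_{(-∞, E]}(B)` meets the kernel of `χ_{(-∞, E]}(A)` trivially: a
common vector `v` satisfies `⟨Bv, v⟩ ≤ E‖v‖²` and, unless it vanishes, `⟨Av, v⟩ > E‖v‖²`. -/
theorem eq_zero_of_spectralProjection {A B : H →L[ℂ] H} (hA : IsSelfAdjoint A)
    (hB : IsSelfAdjoint B) (hAB : ∀ v, (inner ℂ (A v) v).re ≤ (inner ℂ (B v) v).re) (E : ℝ)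
    {v : H} (h1 : spectralProjection B E v = v) (h2 : spectralProjection A E v = 0) : v = 0 := by
  obtain ⟨s, g, hs, hg, e, hd, -, hpos⟩ := exists_pos_neg_part hB E
  obtain ⟨s', g', hs', hg', e', hd', hsg', -⟩ := exists_pos_neg_part hA E
  have hv1 : (s * s) v = 0 := by
    have := spectralProjection_apply_mem B E v
    rwa [h1, e] at this
  have hperp : ∀ w, (s' * s') w = 0 → inner ℂ v w = 0 := by
    intro w hw
    have hv : v ∈ (LinearMap.ker (cfc (fun t : ℝ => max (t - E) 0) A).toLinearMap)ᗮ :=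
      (Submodule.starProjection_apply_eq_zero_iff _).1 h2
    refine Submodule.inner_left_of_mem_orthogonal (K := LinearMap.ker
      (cfc (fun t : ℝ => max (t - E) 0) A).toLinearMap) ?_ hv
    rw [e']
    exact hw
  have hgv : g' v = 0 := by
    refine ext_inner_right ℂ fun w => ?_
    rw [hg'.inner_apply_comm, inner_zero_left]
    refine hperp _ ?_
    rw [← mul_apply_eq_comp, hsg']
    rfl
  have hBv : (inner ℂ (B v) v).re ≤ ((E : ℂ) * inner ℂ v v).re := by
    rw [hd, hv1, add_zero, inner_sub_left, inner_smul_left, Complex.conj_ofReal, Complex.sub_re]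
    linarith [hpos v]
  have hAv : (inner ℂ (A v) v).re = ((E : ℂ) * inner ℂ v v).re + ‖s' v‖ ^ 2 := by
    rw [hd', hgv, sub_zero, inner_add_left, inner_smul_left, Complex.conj_ofReal, Complex.add_re,
      mul_apply_eq_comp, hs'.inner_apply_comm, re_inner_self_eq_norm_sq]
  have hz : ‖s' v‖ ^ 2 ≤ 0 := by linarith [hAB v]
  have hz' : s' v = 0 := by
    rw [← norm_eq_zero]
    exact pow_eq_zero_iff two_ne_zero |>.1 (le_antisymm hz (by positivity))
  exact inner_self_eq_zero.1 (hperp v (by rw [mul_apply_eq_comp, hz', map_zero]))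

/-- Chebyshev's inequality for the spectral measure: if the Rayleigh quotient of `f` is at most
`E / 2`, at least half of the mass of `f` sits on the spectral interval `(-∞, E]`. -/
theorem half_le_norm_spectralProjection_sq {T : H →L[ℂ] H} (hT : IsSelfAdjoint T)
    (hpos : ∀ v, 0 ≤ (inner ℂ (T v) v).re) {E : ℝ} (hE : 0 < E) {f : H}
    (hf : (inner ℂ (T f) f).re ≤ E / 2 * ‖f‖ ^ 2) :
    ‖f‖ ^ 2 / 2 ≤ ‖spectralProjection T E f‖ ^ 2 := by
  obtain ⟨s, g, hs, hg, e, hd, hsg, -⟩ := exists_pos_neg_part hT E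
  set K := LinearMap.ker (cfc (fun t : ℝ => max (t - E) 0) T).toLinearMap with hK
  set u := spectralProjection T E f with hu
  set w := f - u with hw
  have hu' : (s * s) u = 0 := by
    rw [← e]
    exact spectralProjection_apply_mem T E f
  have hperp : ∀ x, (s * s) x = 0 → inner ℂ w x = 0 := by
    intro x hx
    have hv : w ∈ Kᗮ := Submodule.sub_starProjection_mem_orthogonal f
    refine Submodule.inner_left_of_mem_orthogonal (K := K) ?_ hv
    rw [hK, e]
    exact hx
  have hgw : g w = 0 := by
    refine ext_inner_right ℂ fun x => ?_
    rw [hg.inner_apply_comm, inner_zero_left]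
    refine hperp _ ?_
    rw [← mul_apply_eq_comp, hsg]
    rfl
  have hwu : inner ℂ w u = 0 := hperp u hu'
  have huw : inner ℂ u w = 0 := inner_eq_zero_symm.1 hwu
  have hTuw : inner ℂ (T u) w = 0 := by
    rw [hd, hu', add_zero, inner_sub_left, inner_smul_left, huw, hg.inner_apply_comm, hgw]
    simp
  have hTwu : inner ℂ (T w) u = 0 := by
    rw [hT.inner_apply_comm, ← inner_conj_symm, hTuw, map_zero]
  have hTw : (inner ℂ (T w) w).re = E * ‖w‖ ^ 2 + ‖s w‖ ^ 2 := by
    rw [hd, hgw, sub_zero, inner_add_left, inner_smul_left, Complex.conj_ofReal, Complex.add_re,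
      mul_apply_eq_comp, hs.inner_apply_comm, re_inner_self_eq_norm_sq, Complex.re_ofReal_mul,
      re_inner_self_eq_norm_sq]
  have hfu : f = u + w := by rw [hw]; abel
  have h1 : (inner ℂ (T f) f).re = (inner ℂ (T u) u).re + (inner ℂ (T w) w).re := by
    conv_lhs => rw [hfu]
    rw [map_add, inner_add_left, inner_add_right, inner_add_right, hTuw, hTwu]
    simp
  have h2 : ‖f‖ ^ 2 = ‖u‖ ^ 2 + ‖w‖ ^ 2 := by
    conv_lhs => rw [hfu]
    simpa [sq] using norm_add_sq_eq_norm_sq_add_norm_sq_of_inner_eq_zero u w huw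
  have h3 : E * ‖w‖ ^ 2 ≤ E * (‖f‖ ^ 2 / 2) := by
    nlinarith [hpos u, sq_nonneg ‖s w‖]
  have h4 := le_of_mul_le_mul_left h3 hE
  linarith

/-- The mean ergodic theorem for powers of `1 - g`. -/
theorem tendsto_mean_pow_one_sub {g : H →L[ℂ] H} (hg : ‖1 - g‖ ≤ 1) (v : H) :
    Filter.Tendsto (fun n : ℕ => ((n : ℂ)⁻¹ • ∑ k ∈ Finset.range n, (1 - g) ^ k) v) Filter.atTop
      (𝓝 ((LinearMap.ker g.toLinearMap).starProjection v)) := by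
  have hK : ∀ K : Submodule ℂ H, K = LinearMap.ker g.toLinearMap →
      ∀ [K.HasOrthogonalProjection], (K.orthogonalProjectionOnto v : H) =
        (LinearMap.ker g.toLinearMap).starProjection v := by
    rintro K rfl _
    rfl
  rw [← hK ((1 - g).toLinearMap.eqLocus (1 : H →L[ℂ] H).toLinearMap) (by ext x; simp)]
  refine ((1 - g).tendsto_birkhoffAverage_orthogonalProjection hg v).congr fun n => ?_
  rw [smul_apply, birkhoffAverage, birkhoffSum]
  simp

/-- Spectral projections are strong limits of polynomials that depend on the spectral interval and
on a norm bound of the operator only. -/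
theorem exists_polynomial_tendsto_spectralProjection (E R : ℝ) :
    ∃ q : ℕ → Polynomial ℂ, ∀ {H : Type*} [NormedAddCommGroup H] [InnerProductSpace ℂ H]
      [CompleteSpace H] (T : H →L[ℂ] H), IsSelfAdjoint T → ‖T‖ ≤ R → ∀ v : H,
        Filter.Tendsto (fun n => Polynomial.aeval T (q n) v) Filter.atTop
          (𝓝 (spectralProjection T E v)) := by
  -- `c (t - E)₊` takes values in `[0, 1]` on `[-R, R]`.
  set c : ℝ := (|R| + |E| + 1)⁻¹ with hc
  have hc0 : 0 < c := by positivity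
  set h : ℕ → ℝ → ℝ := fun n t =>
    (n : ℝ)⁻¹ * ∑ k ∈ Finset.range n, (1 - c * max (t - E) 0) ^ k with hh
  have hcont : ∀ n, Continuous (h n) := fun n => by fun_prop
  choose q hq using fun n : ℕ => exists_polynomial_near_of_continuousOn (-R) R (h n)
    (hcont n).continuousOn (1 / (n + 1) : ℝ) (by positivity)
  refine ⟨fun n => (q n).map (algebraMap ℝ ℂ), fun {H} _ _ _ T hT hTR v => ?_⟩
  simp only [Polynomial.aeval_map_algebraMap]
  have hspec : ∀ t ∈ spectrum ℝ T, t ∈ Set.Icc (-R) R := fun t ht => by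
    have h1 := spectrum.norm_le_norm_mul_of_mem ht
    have h2 : ‖T‖ * ‖(1 : H →L[ℂ] H)‖ ≤ ‖T‖ * 1 := by
      gcongr
      exact ContinuousLinearMap.norm_id_le
    exact abs_le.1 (h1.trans (h2.trans ((mul_one _).trans_le hTR)))
  set g := cfc (fun t : ℝ => max (t - E) 0) T with hg
  have hcg : 1 - c • g = cfc (fun t : ℝ => 1 - c * max (t - E) 0) T := by
    rw [cfc_sub (fun _ : ℝ => 1) (fun t : ℝ => c * max (t - E) 0) T,
      cfc_const_mul c (fun t : ℝ => max (t - E) 0) T, cfc_const_one ℝ T]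
  have hnorm : ‖1 - c • g‖ ≤ 1 := by
    rw [hcg]
    refine norm_cfc_le zero_le_one fun t ht => ?_
    obtain ⟨h1, h2⟩ := hspec t ht
    have h3 : c * max (t - E) 0 ≤ 1 := by
      rw [hc, inv_mul_le_iff₀ (by positivity), mul_one]
      refine max_le ?_ (by positivity)
      linarith [le_abs_self R, neg_abs_le E]
    have h4 : 0 ≤ c * max (t - E) 0 := by positivity
    rw [Real.norm_eq_abs, abs_le]
    constructor <;> linarith
  have hker : LinearMap.ker (c • g).toLinearMap = LinearMap.ker g.toLinearMap := by
    ext x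
    simp [hc0.ne']
  have hK : ∀ K : Submodule ℂ H, K = LinearMap.ker g.toLinearMap →
      ∀ [K.HasOrthogonalProjection], (LinearMap.ker g.toLinearMap).starProjection =
        K.starProjection := by
    rintro K rfl _
    rfl
  have hlim := tendsto_mean_pow_one_sub hnorm v
  have hmean : ∀ n : ℕ, (n : ℂ)⁻¹ • ∑ k ∈ Finset.range n, (1 - c • g) ^ k = cfc (h n) T := by
    intro n
    rw [← Complex.ofReal_natCast, ← Complex.ofReal_inv, Complex.coe_smul]
    rw [hh, cfc_const_mul _ (fun t : ℝ => ∑ k ∈ Finset.range n, (1 - c * max (t - E) 0) ^ k) T,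
      hcg]
    congr 1
    have hk : ∀ k ∈ Finset.range n, cfc (fun t : ℝ => 1 - c * max (t - E) 0) T ^ k =
        cfc (fun t : ℝ => (1 - c * max (t - E) 0) ^ k) T := fun k _ =>
      (cfc_pow (fun t : ℝ => 1 - c * max (t - E) 0) k T).symm
    rw [Finset.sum_congr rfl hk, ← cfc_sum (fun k t => (1 - c * max (t - E) 0) ^ k) T _
      (fun k _ => by fun_prop)]
    congr 1
    ext t
    simp
  have hdiff : Filter.Tendsto (fun n => Polynomial.aeval T (q n) v - cfc (h n) T v) Filter.atTop
      (𝓝 0) := by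
    have hb : ∀ n, ‖Polynomial.aeval T (q n) v - cfc (h n) T v‖ ≤ 1 / ((n : ℝ) + 1) * ‖v‖ := by
      intro n
      rw [← sub_apply]
      refine (ContinuousLinearMap.le_opNorm _ _).trans ?_
      gcongr
      rw [← cfc_polynomial (q n) T, ← cfc_sub (fun t => (q n).eval t) (h n) T
        (by fun_prop) (hcont n).continuousOn]
      refine norm_cfc_le (by positivity) fun t ht => ?_
      exact (hq n t (hspec t ht)).le
    refine squeeze_zero_norm hb ?_
    simpa using (tendsto_one_div_add_atTop_nhds_zero_nat (𝕜 := ℝ)).mul_const ‖v‖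
  have hsum := hdiff.add hlim
  simp only [hmean, sub_add_cancel, zero_add] at hsum
  convert hsum using 2
  rw [spectralProjection]
  simp only [← hg]
  congr 1
  exact hK _ hker

end Spectral

/-! ### Operators on `ℓ²(V)` and their matrix entries -/

section Entries

open Classical in
/-- The unit vector `δ_x ∈ ℓ²(V)`. -/
noncomputable def unitVec {V : Type*} (x : V) : ℓ²(V, ℂ) := lp.single 2 x (1 : ℂ)

/-- The matrix entry `⟨δ_x, T δ_y⟩`. -/
noncomputable def entry {V : Type*} (T : ℓ²(V, ℂ) →L[ℂ] ℓ²(V, ℂ)) (x y : V) : ℂ :=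
  inner ℂ (unitVec x) (T (unitVec y))

variable {V : Type*}

open Classical in
theorem unitVec_apply (x y : V) : unitVec x y = if y = x then (1 : ℂ) else 0 := by
  simp [unitVec, lp.single_apply, Pi.single_apply]

theorem inner_unitVec_left (x : V) (f : ℓ²(V, ℂ)) : inner ℂ (unitVec x) f = f x := by
  simp [unitVec, lp.inner_single_left]

theorem entry_eq_apply (T : ℓ²(V, ℂ) →L[ℂ] ℓ²(V, ℂ)) (x y : V) :
    entry T x y = T (unitVec y) x := inner_unitVec_left _ _

@[simp]
theorem norm_unitVec (x : V) : ‖(unitVec x : ℓ²(V, ℂ))‖ = 1 := by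
  have := re_inner_self_eq_norm_sq (unitVec x : ℓ²(V, ℂ))
  rw [inner_unitVec_left, unitVec_apply, if_pos rfl, Complex.one_re] at this
  exact (pow_eq_one_iff_of_nonneg (norm_nonneg _) two_ne_zero).1 this.symm

theorem hasSum_unitVec (f : ℓ²(V, ℂ)) : HasSum (fun x => f x • unitVec x) f := by
  classical
  convert lp.hasSum_single (p := 2) (by norm_num) f using 2 with x
  ext y
  simp [unitVec_apply, lp.single_apply, Pi.single_apply]

theorem clm_ext_unitVec {F : Type*} [NormedAddCommGroup F] [NormedSpace ℂ F]
    {T T' : ℓ²(V, ℂ) →L[ℂ] F} (h : ∀ x, T (unitVec x) = T' (unitVec x)) : T = T' := by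
  ext f
  refine ((hasSum_unitVec f).mapL T).unique ?_
  convert (hasSum_unitVec f).mapL T' using 2 with x
  rw [map_smul, map_smul, h]

theorem clm_ext_entry {T T' : ℓ²(V, ℂ) →L[ℂ] ℓ²(V, ℂ)}
    (h : ∀ x y, entry T x y = entry T' x y) : T = T' := by
  refine clm_ext_unitVec fun y => lp.ext (funext fun x => ?_)
  rw [← entry_eq_apply, ← entry_eq_apply, h]

theorem entry_adjoint (T : ℓ²(V, ℂ) →L[ℂ] ℓ²(V, ℂ)) (x y : V) :
    entry T.adjoint x y = starRingEnd ℂ (entry T y x) := by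
  rw [entry, entry, ContinuousLinearMap.adjoint_inner_right, inner_conj_symm]

theorem isSelfAdjoint_of_entry {T : ℓ²(V, ℂ) →L[ℂ] ℓ²(V, ℂ)}
    (h : ∀ x y, entry T x y = starRingEnd ℂ (entry T y x)) : IsSelfAdjoint T := by
  rw [ContinuousLinearMap.isSelfAdjoint_iff']
  exact clm_ext_entry fun x y => by rw [entry_adjoint, ← h]

theorem hasSum_entry_mul (T T' : ℓ²(V, ℂ) →L[ℂ] ℓ²(V, ℂ)) (x y : V) :
    HasSum (fun z => entry T x z * entry T' z y) (entry (T * T') x y) := by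
  have h := ((hasSum_unitVec (T' (unitVec y))).mapL T).mapL (innerSL ℂ (unitVec x))
  have e : (fun z => entry T x z * entry T' z y) = fun z =>
      innerSL ℂ (unitVec x) (T (T' (unitVec y) z • unitVec z)) := funext fun z => by
    rw [entry_eq_apply T', map_smul, map_smul, innerSL_apply_apply, smul_eq_mul, mul_comm]
    rfl
  rw [e]
  exact h

theorem hasSum_norm_sq (f : ℓ²(V, ℂ)) : HasSum (fun x => ‖f x‖ ^ 2) (‖f‖ ^ 2) := by
  have := lp.hasSum_norm (p := 2) (by norm_num) f
  simpa using this

theorem norm_entry_le (T : ℓ²(V, ℂ) →L[ℂ] ℓ²(V, ℂ)) (x y : V) : ‖entry T x y‖ ≤ ‖T‖ := by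
  refine (norm_inner_le_norm _ _).trans ?_
  rw [norm_unitVec, one_mul]
  exact (T.le_opNorm _).trans (by simp)

end Entries

/-! ### The Laplacians of a subgraph -/

namespace SimpleGraph

variable {V : Type*} (G : SimpleGraph V) [BoundedDegree G]

open Classical in
theorem entry_adjacencyOperator (x y : V) :
    entry G.adjacencyOperator x y = if G.Adj x y then 1 else 0 := by
  rw [entry_eq_apply]
  change ∑ z ∈ (G.finite_neighborSet x).toFinset, unitVec y z = _
  simp only [unitVec_apply]
  simp

open Classical in
theorem entry_degreeOperator (x y : V) :
    entry G.degreeOperator x y = if x = y then (G.deg x : ℂ) else 0 := by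
  rw [entry_eq_apply]
  change (G.deg x : ℂ) * unitVec y x = _
  rw [unitVec_apply]
  simp

theorem isSelfAdjoint_adjacencyOperator : IsSelfAdjoint G.adjacencyOperator := by
  classical
  refine isSelfAdjoint_of_entry fun x y => ?_
  rw [entry_adjacencyOperator, entry_adjacencyOperator, G.adj_comm]
  split_ifs <;> simp

theorem isSelfAdjoint_degreeOperator : IsSelfAdjoint G.degreeOperator := by
  classical
  refine isSelfAdjoint_of_entry fun x y => ?_
  rw [entry_degreeOperator, entry_degreeOperator]
  by_cases h : x = y
  · subst h; simp
  · simp [h, Ne.symm h]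

theorem norm_adjacencyOperator_le {K : ℕ} (hK : ∀ x, G.deg x ≤ K) :
    ‖G.adjacencyOperator‖ ≤ K := by
  refine ContinuousLinearMap.opNorm_le_bound _ (by positivity) fun φ => ?_
  refine lp.norm_le_of_forall_sum_le (p := 2) (by norm_num) (by positivity) fun F => ?_
  simp only [ENNReal.toReal_ofNat, Real.rpow_ofNat]
  exact G.sum_norm_adjFun_sq_le hK φ F

theorem norm_degreeOperator_le {K : ℕ} (hK : ∀ x, G.deg x ≤ K) :
    ‖G.degreeOperator‖ ≤ K := by
  refine ContinuousLinearMap.opNorm_le_bound _ (by positivity) fun φ => ?_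
  refine lp.norm_le_of_forall_sum_le (p := 2) (by norm_num) (by positivity) fun F => ?_
  simp only [ENNReal.toReal_ofNat, Real.rpow_ofNat]
  exact G.sum_norm_deg_mul_sq_le hK φ F

end SimpleGraph

namespace Percolation

open SimpleGraph

theorem re_inner_le_of_norm_le {H : Type*} [NormedAddCommGroup H] [InnerProductSpace ℂ H]
    {T : H →L[ℂ] H} {K : ℝ} (hT : ‖T‖ ≤ K) (v : H) :
    (inner ℂ (T v) v).re ≤ K * ‖v‖ ^ 2 := by
  calc (inner ℂ (T v) v).re ≤ ‖inner ℂ (T v) v‖ := Complex.re_le_norm _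
    _ ≤ ‖T v‖ * ‖v‖ := norm_inner_le_norm _ _
    _ ≤ K * ‖v‖ * ‖v‖ := by gcongr; exact T.le_of_opNorm_le hT v
    _ = _ := by ring

variable {V : Type*} {G : SimpleGraph V} (G' : G.Subgraph)

section Laplacian

variable [BoundedDegree G] {k : ℕ}

theorem isSelfAdjoint_laplacian (bc : BoundaryCondition) :
    IsSelfAdjoint (laplacian k G' bc) := by
  have h1 : ∀ r : ℝ, IsSelfAdjoint ((r : ℂ) • (1 : ℓ²(G'.verts, ℂ) →L[ℂ] ℓ²(G'.verts, ℂ))) :=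
    fun r => by
      refine IsSelfAdjoint.smul (Complex.conj_ofReal r) ?_
      exact IsSelfAdjoint.one _
  cases bc
  · exact (by simpa using h1 k : IsSelfAdjoint _).sub G'.coe.isSelfAdjoint_adjacencyOperator
  · exact ((by simpa using h1 (2 * k) : IsSelfAdjoint _).sub
      G'.coe.isSelfAdjoint_degreeOperator).sub G'.coe.isSelfAdjoint_adjacencyOperator

theorem re_inner_adjacency_nonneg (hk : ∀ x, G'.coe.deg x ≤ k) (v : ℓ²(G'.verts, ℂ)) :
    0 ≤ (inner ℂ (laplacian k G' .adjacency v) v).re := by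
  have h := re_inner_le_of_norm_le (G'.coe.norm_adjacencyOperator_le hk) v
  have h2 := re_inner_self_eq_norm_sq v
  simp only [laplacian, sub_apply, smul_apply, inner_sub_left, inner_smul_left, one_apply_eq_self,
    Complex.sub_re, Complex.conj_natCast]
  rw [← Complex.ofReal_natCast, Complex.re_ofReal_mul, h2]
  linarith

theorem re_inner_adjacency_le_dirichlet (hk : ∀ x, G'.coe.deg x ≤ k) (v : ℓ²(G'.verts, ℂ)) :
    (inner ℂ (laplacian k G' .adjacency v) v).re ≤
      (inner ℂ (laplacian k G' .dirichlet v) v).re := by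
  have h := re_inner_le_of_norm_le (G'.coe.norm_degreeOperator_le hk) v
  have h2 := re_inner_self_eq_norm_sq v
  simp only [laplacian, sub_apply, smul_apply, inner_sub_left, inner_smul_left, one_apply_eq_self,
    Complex.sub_re, Complex.conj_natCast, map_mul, map_ofNat, mul_assoc]
  rw [← mul_assoc, ← Complex.ofReal_natCast, ← Complex.ofReal_ofNat, ← Complex.ofReal_mul,
    Complex.re_ofReal_mul, Complex.re_ofReal_mul, h2]
  linarith

theorem norm_laplacian_le (hk : ∀ x, G'.coe.deg x ≤ k) (bc : BoundaryCondition) :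
    ‖laplacian k G' bc‖ ≤ 4 * k := by
  have hA := G'.coe.norm_adjacencyOperator_le hk
  have hD := G'.coe.norm_degreeOperator_le hk
  have h1 : ∀ r : ℂ, ‖r • (1 : ℓ²(G'.verts, ℂ) →L[ℂ] ℓ²(G'.verts, ℂ))‖ ≤ ‖r‖ := fun r => by
    rw [norm_smul]
    exact mul_le_of_le_one_right (norm_nonneg _) ContinuousLinearMap.norm_id_le
  cases bc
  · refine (norm_sub_le _ _).trans ?_
    have := h1 k
    rw [Complex.norm_natCast] at this
    have : (0 : ℝ) ≤ k := by positivity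
    linarith
  · refine (norm_sub_le _ _).trans ((add_le_add_left (norm_sub_le _ _) _).trans ?_)
    have := h1 (2 * k)
    rw [norm_mul, Complex.norm_natCast, Complex.norm_ofNat] at this
    linarith

end Laplacian

/-! ### Extension of operators by zero -/

/-- Extension by zero, `ℓ²(V') → ℓ²(V)`. -/
noncomputable def inclusion : ℓ²(G'.verts, ℂ) →ₗᵢ[ℂ] ℓ²(V, ℂ) :=
  (Orthonormal.orthogonalFamily (𝕜 := ℂ) (v := fun x : G'.verts => (unitVec (x : V) : ℓ²(V, ℂ)))
    (by
      classical
      rw [orthonormal_iff_ite]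
      intro x y
      rw [inner_unitVec_left, unitVec_apply]
      simp [Subtype.ext_iff])).linearIsometry

theorem inclusion_unitVec (x : G'.verts) : inclusion G' (unitVec x) = unitVec (x : V) := by
  classical
  rw [inclusion, unitVec, OrthogonalFamily.linearIsometry_apply_single]
  simp

theorem adjoint_inclusion_unitVec (x : V) :
    (inclusion G').toContinuousLinearMap.adjoint (unitVec x) = delta G' x := by
  classical
  refine lp.ext (funext fun y => ?_)
  rw [← inner_unitVec_left, ContinuousLinearMap.adjoint_inner_right]
  change inner ℂ (inclusion G' (unitVec y)) (unitVec x) = _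
  rw [inclusion_unitVec, inner_unitVec_left, unitVec_apply, delta]
  split_ifs with h h' h'
  · simp [lp.single_apply, ← h]
  · exact absurd (h ▸ y.2) h'
  · have : y ≠ ⟨x, h'⟩ := fun h2 => h (by rw [h2])
    simp [lp.single_apply, this]
  · simp

theorem adjoint_inclusion_inclusion (v : ℓ²(G'.verts, ℂ)) :
    (inclusion G').toContinuousLinearMap.adjoint (inclusion G' v) = v := by
  refine ext_inner_right ℂ fun w => ?_
  rw [ContinuousLinearMap.adjoint_inner_left]
  exact (inclusion G').inner_map_map v w

/-- The extension by zero `J T J*` of an operator `T` on `ℓ²(V')` to `ℓ²(V)`. -/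
noncomputable def extend (T : ℓ²(G'.verts, ℂ) →L[ℂ] ℓ²(G'.verts, ℂ)) :
    ℓ²(V, ℂ) →L[ℂ] ℓ²(V, ℂ) :=
  (inclusion G').toContinuousLinearMap ∘L T ∘L (inclusion G').toContinuousLinearMap.adjoint

theorem extend_apply (T : ℓ²(G'.verts, ℂ) →L[ℂ] ℓ²(G'.verts, ℂ)) (v : ℓ²(V, ℂ)) :
    extend G' T v = inclusion G' (T ((inclusion G').toContinuousLinearMap.adjoint v)) := rfl

theorem extend_mul (T T' : ℓ²(G'.verts, ℂ) →L[ℂ] ℓ²(G'.verts, ℂ)) :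
    extend G' (T * T') = extend G' T * extend G' T' := by
  ext1 v
  simp only [extend_apply, mul_apply_eq_comp, adjoint_inclusion_inclusion]

theorem extend_add (T T' : ℓ²(G'.verts, ℂ) →L[ℂ] ℓ²(G'.verts, ℂ)) :
    extend G' (T + T') = extend G' T + extend G' T' := by
  ext1 v
  simp only [extend_apply, add_apply, map_add]

theorem extend_sub (T T' : ℓ²(G'.verts, ℂ) →L[ℂ] ℓ²(G'.verts, ℂ)) :
    extend G' (T - T') = extend G' T - extend G' T' := by
  ext1 v
  simp only [extend_apply, sub_apply, map_sub]

theorem extend_smul (c : ℂ) (T : ℓ²(G'.verts, ℂ) →L[ℂ] ℓ²(G'.verts, ℂ)) :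
    extend G' (c • T) = c • extend G' T := by
  ext1 v
  simp only [extend_apply, smul_apply, map_smul]

theorem adjoint_extend (T : ℓ²(G'.verts, ℂ) →L[ℂ] ℓ²(G'.verts, ℂ)) :
    (extend G' T).adjoint = extend G' T.adjoint := by
  simp only [extend, ContinuousLinearMap.adjoint_comp, ContinuousLinearMap.adjoint_adjoint,
    ContinuousLinearMap.comp_assoc]

theorem norm_extend_le (T : ℓ²(G'.verts, ℂ) →L[ℂ] ℓ²(G'.verts, ℂ)) : ‖extend G' T‖ ≤ ‖T‖ := by
  refine ContinuousLinearMap.opNorm_le_bound _ (norm_nonneg _) fun v => ?_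
  rw [extend_apply, LinearIsometry.norm_map]
  refine (T.le_opNorm _).trans ?_
  gcongr
  refine (ContinuousLinearMap.le_opNorm _ _).trans ?_
  rw [LinearIsometryEquiv.norm_map]
  exact mul_le_of_le_one_left (norm_nonneg _) (inclusion G').norm_toContinuousLinearMap_le

theorem entry_extend (T : ℓ²(G'.verts, ℂ) →L[ℂ] ℓ²(G'.verts, ℂ)) (x y : V) :
    entry (extend G' T) x y = inner ℂ (delta G' x) (T (delta G' y)) := by
  rw [entry, extend_apply, ← adjoint_inclusion_unitVec, ← adjoint_inclusion_unitVec,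
    ContinuousLinearMap.adjoint_inner_left]
  rfl

open Classical in
theorem entry_extend_eq_ite (T : ℓ²(G'.verts, ℂ) →L[ℂ] ℓ²(G'.verts, ℂ)) (x y : V) :
    entry (extend G' T) x y =
      if h : x ∈ G'.verts ∧ y ∈ G'.verts then entry T ⟨x, h.1⟩ ⟨y, h.2⟩ else 0 := by
  rw [entry_extend, delta, delta]
  by_cases hx : x ∈ G'.verts <;> by_cases hy : y ∈ G'.verts <;> simp [hx, hy, entry, unitVec]
  congr!

open Classical in
theorem entry_extend_one (x y : V) :
    entry (extend G' 1) x y = if x = y ∧ x ∈ G'.verts then 1 else 0 := by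
  rw [entry_extend_eq_ite]
  simp only [entry_eq_apply, one_apply_eq_self, unitVec_apply]
  by_cases hxy : x = y
  · subst hxy
    simp
  · simp [hxy]

open Classical in
theorem entry_extend_adjacencyOperator [BoundedDegree G] (x y : V) :
    entry (extend G' G'.coe.adjacencyOperator) x y = if G'.Adj x y then 1 else 0 := by
  rw [entry_extend_eq_ite]
  simp only [entry_adjacencyOperator, Subgraph.coe_adj]
  split_ifs with h1 _ h2
  · rfl
  · rfl
  · exact absurd ⟨h2.fst_mem, h2.snd_mem⟩ h1
  · rfl

open Classical in
theorem entry_extend_degreeOperator [BoundedDegree G] (x y : V) :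
    entry (extend G' G'.coe.degreeOperator) x y =
      if x = y then ((G'.neighborSet x).ncard : ℂ) else 0 := by
  have hd : ∀ h : x ∈ G'.verts, G'.coe.deg ⟨x, h⟩ = (G'.neighborSet x).ncard := fun h => by
    rw [deg, ← Set.ncard_image_of_injective _ Subtype.val_injective]
    congr 1
    ext z
    simp only [Set.mem_image, mem_neighborSet, Subgraph.coe_adj, Subtype.exists, exists_and_right,
      exists_eq_right, Subgraph.mem_neighborSet]
    exact ⟨fun ⟨_, h⟩ => h, fun h => ⟨h.snd_mem, h⟩⟩
  rw [entry_extend_eq_ite]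
  simp only [entry_degreeOperator]
  by_cases hx : x ∈ G'.verts
  · by_cases hxy : x = y
    · subst hxy
      simp [hx, hd]
    · simp [hxy]
  · have : G'.neighborSet x = ∅ := by
      ext z
      simpa using fun h => hx (Subgraph.Adj.fst_mem h)
    simp [hx, this]

end Percolation

/-! ### The trace on equivariant random operators -/

namespace Percolation

open MeasureTheory

/-- `(1 - A B)ᵏ = 1 - A C B` and `(1 - B A)ᵏ = 1 - C B A` with `C = ∑_{j < k} (1 - B A)ʲ`. -/
theorem one_sub_mul_pow {R : Type*} [Ring R] (A B : R) (k : ℕ) :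
    (1 - A * B) ^ k = 1 - A * ((∑ j ∈ Finset.range k, (1 - B * A) ^ j) * B) := by
  have hs : ∀ j, A * (1 - B * A) ^ j = (1 - A * B) ^ j * A := fun j => by
    have h : SemiconjBy A (1 - B * A) (1 - A * B) := by
      simp only [SemiconjBy, mul_sub, sub_mul, mul_one, one_mul, mul_assoc]
    exact (h.pow_right j).eq
  rw [← mul_assoc, Finset.mul_sum, Finset.sum_congr rfl fun j _ => hs j, ← Finset.sum_mul,
    mul_assoc]
  have := geom_sum_mul_neg (1 - A * B) k
  rw [sub_sub_cancel] at this
  rw [this, sub_sub_cancel]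

theorem norm_one_sub_adjoint_mul_le {H : Type*} [NormedAddCommGroup H] [InnerProductSpace ℂ H]
    [CompleteSpace H] {A : H →L[ℂ] H} (hA : ‖A‖ ≤ 1) : ‖1 - A.adjoint * A‖ ≤ 1 := by
  have h0 : 0 ≤ A.adjoint * A := star_mul_self_nonneg A
  have h1 : A.adjoint * A ≤ 1 := by
    rw [← CStarAlgebra.norm_le_one_iff_of_nonneg _ h0]
    refine (norm_mul_le _ _).trans ?_
    rw [LinearIsometryEquiv.norm_map]
    exact mul_le_one₀ hA (norm_nonneg _) hA
  rw [CStarAlgebra.norm_le_one_iff_of_nonneg _ (sub_nonneg.2 h1)]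
  exact sub_le_self _ h0

theorem norm_mean_pow_le {H : Type*} [NormedAddCommGroup H] [NormedSpace ℂ H]
    {A : H →L[ℂ] H} (hA : ‖A‖ ≤ 1) (n : ℕ) :
    ‖((n : ℂ)⁻¹ • ∑ k ∈ Finset.range n, A ^ k)‖ ≤ 1 := by
  have h : ∀ k, ‖A ^ k‖ ≤ 1 := fun k => by
    induction k with
    | zero => exact ContinuousLinearMap.norm_id_le
    | succ k ih =>
      rw [pow_succ]
      exact (norm_mul_le _ _).trans (mul_le_one₀ ih (norm_nonneg _) hA)
  have h2 : ‖∑ k ∈ Finset.range n, A ^ k‖ ≤ n := by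
    simpa using norm_sum_le_of_le (Finset.range n) (fun k _ => h k)
  rw [norm_smul, norm_inv, Complex.norm_natCast]
  rcases Nat.eq_zero_or_pos n with rfl | hn
  · simp
  · rw [inv_mul_le_iff₀ (by positivity), mul_one]
    exact h2

theorem entry_self_re {V : Type*} {P : ℓ²(V, ℂ) →L[ℂ] ℓ²(V, ℂ)} (hP : IsStarProjection P) (x : V) :
    (entry P x x).re = ‖P (unitVec x)‖ ^ 2 := by
  rw [entry, ← re_inner_self_eq_norm_sq, hP.isSelfAdjoint.inner_apply_comm,
    ← mul_apply_eq_comp, hP.isIdempotentElem.eq]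

/-- A bounded measurable family of operators on `ℓ²(Γ)`, indexed by a space `Ω` with maps
`θ_g : Ω → Ω`, `g ∈ Γ`, that is equivariant: `⟨δ_x, T(θ_g ω) δ_y⟩ = ⟨δ_{gx}, T(ω) δ_{gy}⟩`. -/
structure IsEquivariant {Γ Ω : Type*} [Group Γ] [MeasurableSpace Ω] (θ : Γ → Ω → Ω)
    (T : Ω → ℓ²(Γ, ℂ) →L[ℂ] ℓ²(Γ, ℂ)) : Prop where
  measurable_entry : ∀ x y, Measurable fun ω => entry (T ω) x y
  entry_translate : ∀ g ω x y, entry (T (θ g ω)) x y = entry (T ω) (g * x) (g * y)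
  exists_bound : ∃ C, ∀ ω, ‖T ω‖ ≤ C

/-- The trace `𝔼 ⟨δ_1, T δ_1⟩` of a random operator. -/
noncomputable def trace {Γ Ω : Type*} [Group Γ] [MeasurableSpace Ω] (μ : Measure Ω)
    (T : Ω → ℓ²(Γ, ℂ) →L[ℂ] ℓ²(Γ, ℂ)) : ℂ :=
  ∫ ω, entry (T ω) 1 1 ∂μ

variable {Γ Ω : Type*} [Group Γ] [MeasurableSpace Ω] {θ : Γ → Ω → Ω}
  {T T' : Ω → ℓ²(Γ, ℂ) →L[ℂ] ℓ²(Γ, ℂ)}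

namespace IsEquivariant

theorem one : IsEquivariant θ (fun _ => (1 : ℓ²(Γ, ℂ) →L[ℂ] ℓ²(Γ, ℂ))) := by
  classical
  refine ⟨fun x y => measurable_const, fun g ω x y => ?_, 1,
    fun _ => ContinuousLinearMap.norm_id_le⟩
  simp [entry_eq_apply, unitVec_apply]

theorem add (hT : IsEquivariant θ T) (hT' : IsEquivariant θ T') :
    IsEquivariant θ (fun ω => T ω + T' ω) := by
  have h : ∀ ω x y, entry (T ω + T' ω) x y = entry (T ω) x y + entry (T' ω) x y := by
    intro ω x y
    simp [entry]
  obtain ⟨C, hC⟩ := hT.exists_bound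
  obtain ⟨C', hC'⟩ := hT'.exists_bound
  refine ⟨fun x y => ?_, fun g ω x y => ?_, C + C',
    fun ω => (norm_add_le _ _).trans (add_le_add (hC ω) (hC' ω))⟩
  · simp only [h]
    exact (hT.measurable_entry x y).add (hT'.measurable_entry x y)
  · rw [h, h, hT.entry_translate, hT'.entry_translate]

theorem smul (hT : IsEquivariant θ T) (c : ℂ) : IsEquivariant θ (fun ω => c • T ω) := by
  have h : ∀ ω x y, entry (c • T ω) x y = c * entry (T ω) x y := by
    intro ω x y
    simp [entry]
  obtain ⟨C, hC⟩ := hT.exists_bound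
  refine ⟨fun x y => ?_, fun g ω x y => ?_, ‖c‖ * C, fun ω => ?_⟩
  · simp only [h]
    exact (hT.measurable_entry x y).const_mul c
  · rw [h, h, hT.entry_translate]
  · rw [norm_smul]
    gcongr
    exact hC ω

theorem sub (hT : IsEquivariant θ T) (hT' : IsEquivariant θ T') :
    IsEquivariant θ (fun ω => T ω - T' ω) := by
  convert hT.add (hT'.smul (-1)) using 2 with ω
  simp [sub_eq_add_neg]

theorem sum {ι : Type*} (s : Finset ι) {T : ι → Ω → ℓ²(Γ, ℂ) →L[ℂ] ℓ²(Γ, ℂ)}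
    (hT : ∀ i ∈ s, IsEquivariant θ (T i)) : IsEquivariant θ (fun ω => ∑ i ∈ s, T i ω) := by
  classical
  induction s using Finset.induction_on with
  | empty => simpa using (one (θ := θ)).smul 0
  | insert i s hi ih =>
    simp only [Finset.sum_insert hi]
    exact (hT i (Finset.mem_insert_self _ _)).add
      (ih fun j hj => hT j (Finset.mem_insert_of_mem hj))

theorem mul [Countable Γ] (hT : IsEquivariant θ T) (hT' : IsEquivariant θ T') :
    IsEquivariant θ (fun ω => T ω * T' ω) := by
  obtain ⟨C, hC⟩ := hT.exists_bound
  obtain ⟨C', hC'⟩ := hT'.exists_bound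
  refine ⟨fun x y => ?_, fun g ω x y => ?_, C * C', fun ω => (norm_mul_le _ _).trans
    (mul_le_mul (hC ω) (hC' ω) (norm_nonneg _) ((norm_nonneg _).trans (hC ω)))⟩
  · refine measurable_of_tendsto_metrizable' Filter.atTop
      (f := fun (s : Finset Γ) ω => ∑ z ∈ s, entry (T ω) x z * entry (T' ω) z y)
      (fun s => Finset.measurable_sum s fun z _ =>
        (hT.measurable_entry x z).mul (hT'.measurable_entry z y)) ?_
    rw [tendsto_pi_nhds]
    exact fun ω => hasSum_entry_mul (T ω) (T' ω) x y
  · refine (hasSum_entry_mul (T (θ g ω)) (T' (θ g ω)) x y).unique ?_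
    convert (Equiv.mulLeft g).hasSum_iff.2 (hasSum_entry_mul (T ω) (T' ω) (g * x) (g * y))
      using 2 with z
    simp [hT.entry_translate, hT'.entry_translate]

theorem pow [Countable Γ] (hT : IsEquivariant θ T) (n : ℕ) :
    IsEquivariant θ (fun ω => T ω ^ n) := by
  induction n with
  | zero => simpa using one
  | succ n ih => simpa only [pow_succ] using ih.mul hT

theorem adjoint (hT : IsEquivariant θ T) : IsEquivariant θ (fun ω => (T ω).adjoint) := by
  obtain ⟨C, hC⟩ := hT.exists_bound
  refine ⟨fun x y => ?_, fun g ω x y => ?_, C, fun ω => ?_⟩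
  · simp only [entry_adjoint]
    exact Complex.continuous_conj.measurable.comp (hT.measurable_entry y x)
  · rw [entry_adjoint, entry_adjoint, hT.entry_translate]
  · rw [LinearIsometryEquiv.norm_map]
    exact hC ω

theorem of_tendsto {F : ℕ → Ω → ℓ²(Γ, ℂ) →L[ℂ] ℓ²(Γ, ℂ)} (hF : ∀ n, IsEquivariant θ (F n))
    (hlim : ∀ ω x y, Filter.Tendsto (fun n => entry (F n ω) x y) Filter.atTop
      (𝓝 (entry (T ω) x y))) (hb : ∃ C, ∀ ω, ‖T ω‖ ≤ C) : IsEquivariant θ T := by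
  refine ⟨fun x y => ?_, fun g ω x y => ?_, hb⟩
  · refine measurable_of_tendsto_metrizable (fun n => (hF n).measurable_entry x y) ?_
    rw [tendsto_pi_nhds]
    exact fun ω => hlim ω x y
  · refine tendsto_nhds_unique (hlim (θ g ω) x y) ?_
    simp only [(hF _).entry_translate]
    exact hlim ω _ _

theorem measurable_entry_mul (hT : IsEquivariant θ T) (hT' : IsEquivariant θ T') (x y z : Γ) :
    Measurable fun ω => entry (T ω) x y * entry (T' ω) y z :=
  (hT.measurable_entry x y).mul (hT'.measurable_entry y z)

variable {μ : Measure Ω}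

/-- All diagonal entries of an equivariant operator have the same mean. -/
theorem integral_entry_self (hT : IsEquivariant θ T) (hθ : ∀ g, MeasurePreserving (θ g) μ μ)
    (x : Γ) : ∫ ω, entry (T ω) x x ∂μ = trace μ T := by
  have h := (hθ x).map_eq ▸ integral_map (μ := μ) (hθ x).measurable.aemeasurable
    (f := fun ω => entry (T ω) 1 1) (hT.measurable_entry 1 1).aestronglyMeasurable
  rw [trace, h]
  simp [hT.entry_translate]

variable [IsProbabilityMeasure μ]

theorem integrable_entry (hT : IsEquivariant θ T) (x y : Γ) :
    Integrable (fun ω => entry (T ω) x y) μ := by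
  obtain ⟨C, hC⟩ := hT.exists_bound
  exact Integrable.of_bound (hT.measurable_entry x y).aestronglyMeasurable C
    (Filter.Eventually.of_forall fun ω => (norm_entry_le _ _ _).trans (hC ω))

theorem trace_sub (hT : IsEquivariant θ T) (hT' : IsEquivariant θ T') :
    trace μ (fun ω => T ω - T' ω) = trace μ T - trace μ T' := by
  rw [trace, trace, trace, ← integral_sub (hT.integrable_entry 1 1) (hT'.integrable_entry 1 1)]
  simp [entry]

theorem trace_sum {ι : Type*} (s : Finset ι) {T : ι → Ω → ℓ²(Γ, ℂ) →L[ℂ] ℓ²(Γ, ℂ)}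
    (hT : ∀ i ∈ s, IsEquivariant θ (T i)) :
    trace μ (fun ω => ∑ i ∈ s, T i ω) = ∑ i ∈ s, trace μ (T i) := by
  simp only [trace]
  rw [← integral_finsetSum s fun i hi => (hT i hi).integrable_entry 1 1]
  simp [entry]

/-- The matrix entries of a product are summable, uniformly in `ω`. -/
theorem tsum_lintegral_ne_top [Countable Γ] (hT : IsEquivariant θ T) (hT' : IsEquivariant θ T') :
    ∑' z, ∫⁻ ω, ‖entry (T ω) 1 z * entry (T' ω) z 1‖ₑ ∂μ ≠ ⊤ := by
  obtain ⟨C, hC⟩ := hT.exists_bound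
  obtain ⟨C', hC'⟩ := hT'.exists_bound
  have key : ∀ ω, ∑' z, ‖entry (T ω) 1 z * entry (T' ω) z 1‖ₑ ≤
      ENNReal.ofReal (C ^ 2 + C' ^ 2) := by
    intro ω
    have h1 := hasSum_norm_sq ((T ω).adjoint (unitVec 1))
    have h2 := hasSum_norm_sq (T' ω (unitVec 1))
    have hle : ∀ z, ‖entry (T ω) 1 z * entry (T' ω) z 1‖ ≤
        ‖(T ω).adjoint (unitVec 1) z‖ ^ 2 + ‖T' ω (unitVec 1) z‖ ^ 2 := by
      intro z
      have e : ‖entry (T ω) 1 z‖ = ‖(T ω).adjoint (unitVec 1) z‖ := by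
        rw [← entry_eq_apply, entry_adjoint, RCLike.norm_conj]
      rw [norm_mul, e, entry_eq_apply]
      nlinarith [sq_nonneg (‖(T ω).adjoint (unitVec 1) z‖ - ‖T' ω (unitVec 1) z‖),
        sq_nonneg ‖(T ω).adjoint (unitVec 1) z‖, sq_nonneg ‖T' ω (unitVec 1) z‖]
    calc ∑' z, ‖entry (T ω) 1 z * entry (T' ω) z 1‖ₑ
        ≤ ∑' z, ENNReal.ofReal
          (‖(T ω).adjoint (unitVec 1) z‖ ^ 2 + ‖T' ω (unitVec 1) z‖ ^ 2) := by
          refine ENNReal.tsum_le_tsum fun z => ?_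
          rw [← ofReal_norm]
          exact ENNReal.ofReal_le_ofReal (hle z)
      _ = ENNReal.ofReal (‖(T ω).adjoint (unitVec 1)‖ ^ 2 + ‖T' ω (unitVec 1)‖ ^ 2) := by
          rw [← ENNReal.ofReal_tsum_of_nonneg (fun z => by positivity) (h1.add h2).summable,
            (h1.add h2).tsum_eq]
      _ ≤ _ := by
          refine ENNReal.ofReal_le_ofReal ?_
          have b1 : ‖(T ω).adjoint (unitVec 1)‖ ≤ C := by
            refine (ContinuousLinearMap.le_opNorm _ _).trans ?_
            rw [LinearIsometryEquiv.norm_map, norm_unitVec, mul_one]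
            exact hC ω
          have b2 : ‖T' ω (unitVec 1)‖ ≤ C' := by
            refine (ContinuousLinearMap.le_opNorm _ _).trans ?_
            rw [norm_unitVec, mul_one]
            exact hC' ω
          gcongr
  rw [← lintegral_tsum fun z =>
    (hT.measurable_entry_mul hT' 1 z 1).enorm.aemeasurable]
  refine ((lintegral_mono key).trans_lt ?_).ne
  simp

/-- The trace property, by mass transport: translating by `z⁻¹` turns
`𝔼 ⟨δ_1, T δ_z⟩⟨δ_z, T' δ_1⟩` into `𝔼 ⟨δ_1, T' δ_{z⁻¹}⟩⟨δ_{z⁻¹}, T δ_1⟩`. -/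
theorem trace_mul_comm [Countable Γ] (hT : IsEquivariant θ T) (hT' : IsEquivariant θ T')
    (hθ : ∀ g, MeasurePreserving (θ g) μ μ) :
    trace μ (fun ω => T ω * T' ω) = trace μ (fun ω => T' ω * T ω) := by
  have expand : ∀ {A B : Ω → ℓ²(Γ, ℂ) →L[ℂ] ℓ²(Γ, ℂ)}, IsEquivariant θ A → IsEquivariant θ B →
      trace μ (fun ω => A ω * B ω) = ∑' z, ∫ ω, entry (A ω) 1 z * entry (B ω) z 1 ∂μ := by
    intro A B hA hB
    rw [trace, ← integral_tsum (fun z =>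
      (hA.measurable_entry_mul hB 1 z 1).aestronglyMeasurable) (hA.tsum_lintegral_ne_top hB)]
    exact integral_congr_ae (Filter.Eventually.of_forall fun ω =>
      (hasSum_entry_mul (A ω) (B ω) 1 1).tsum_eq.symm)
  rw [expand hT hT', expand hT' hT, ← (Equiv.inv Γ).tsum_eq]
  refine tsum_congr fun z => ?_
  have h := (hθ z).map_eq ▸ integral_map (μ := μ) (hθ z).measurable.aemeasurable
    (f := fun ω => entry (T ω) 1 z⁻¹ * entry (T' ω) z⁻¹ 1)
    (hT.measurable_entry_mul hT' 1 z⁻¹ 1).aestronglyMeasurable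
  rw [Equiv.inv_apply, h]
  simp [hT.entry_translate, hT'.entry_translate, mul_comm]

theorem trace_one_sub_mul_pow [Countable Γ] (hT : IsEquivariant θ T) (hT' : IsEquivariant θ T')
    (hθ : ∀ g, MeasurePreserving (θ g) μ μ) (k : ℕ) :
    trace μ (fun ω => (1 - T ω * T' ω) ^ k) = trace μ (fun ω => (1 - T' ω * T ω) ^ k) := by
  have hC : IsEquivariant θ (fun ω => (∑ j ∈ Finset.range k, (1 - T' ω * T ω) ^ j) * T' ω) :=
    (sum _ fun j _ => (one.sub (hT'.mul hT)).pow j).mul hT'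
  have h2 : ∀ ω, (1 - T' ω * T ω) ^ k =
      1 - (∑ j ∈ Finset.range k, (1 - T' ω * T ω) ^ j) * T' ω * T ω := fun ω => by
    have := geom_sum_mul_neg (1 - T' ω * T ω) k
    rw [sub_sub_cancel] at this
    rw [mul_assoc, this, sub_sub_cancel]
  simp only [one_sub_mul_pow (T _) (T' _)]
  conv_rhs => simp only [h2]
  rw [trace_sub one (hT.mul hC), trace_sub one (hC.mul hT), hT.trace_mul_comm hC hθ]

/-- The projection onto the kernel of `T(ω)` is equivariant as the limit of the means of the powers
of `1 - T(ω)`, and its trace is the limit of the means of their traces. -/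
theorem mean_ergodic [Countable Γ] (hT : IsEquivariant θ T) (h1 : ∀ ω, ‖1 - T ω‖ ≤ 1) :
    IsEquivariant θ (fun ω => (LinearMap.ker (T ω).toLinearMap).starProjection) ∧
    Filter.Tendsto (fun n : ℕ => (n : ℂ)⁻¹ * ∑ k ∈ Finset.range n,
      trace μ (fun ω => (1 - T ω) ^ k)) Filter.atTop
      (𝓝 (trace μ (fun ω => (LinearMap.ker (T ω).toLinearMap).starProjection))) := by
  set a : ℕ → Ω → ℓ²(Γ, ℂ) →L[ℂ] ℓ²(Γ, ℂ) := fun n ω =>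
    (n : ℂ)⁻¹ • ∑ k ∈ Finset.range n, (1 - T ω) ^ k with ha
  have hsum : ∀ n : ℕ, IsEquivariant θ (fun ω => ∑ k ∈ Finset.range n, (1 - T ω) ^ k) :=
    fun n => sum _ fun k _ => (one.sub hT).pow k
  have haE : ∀ n, IsEquivariant θ (a n) := fun n => (hsum n).smul _
  have hlim : ∀ ω x y, Filter.Tendsto (fun n => entry (a n ω) x y) Filter.atTop
      (𝓝 (entry (LinearMap.ker (T ω).toLinearMap).starProjection x y)) := by
    intro ω x y
    exact Filter.Tendsto.inner tendsto_const_nhds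
      (tendsto_mean_pow_one_sub (h1 ω) (unitVec y))
  refine ⟨of_tendsto haE hlim ⟨1, fun ω => Submodule.starProjection_norm_le _⟩, ?_⟩
  have htr : ∀ n, trace μ (a n) =
      (n : ℂ)⁻¹ * ∑ k ∈ Finset.range n, trace μ (fun ω => (1 - T ω) ^ k) := by
    intro n
    rw [← trace_sum _ fun k _ => (one.sub hT).pow k, trace, trace, ← integral_const_mul]
    simp [entry, ha]
  simp only [← htr]
  refine tendsto_integral_of_dominated_convergence (fun _ => 1)
    (fun n => ((haE n).measurable_entry 1 1).aestronglyMeasurable) (integrable_const _)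
    (fun n => Filter.Eventually.of_forall fun ω => ?_)
    (Filter.Eventually.of_forall fun ω => hlim ω 1 1)
  exact (norm_entry_le _ _ _).trans (norm_mean_pow_le (h1 ω) n)

/-- The kernels of an equivariant contraction and of its adjoint have the same trace: by the mean
ergodic theorem their projections are limits of means of powers of `1 - T*T` and `1 - TT*`. -/
theorem trace_ker_eq_trace_ker_adjoint [Countable Γ] (hT : IsEquivariant θ T)
    (hθ : ∀ g, MeasurePreserving (θ g) μ μ) (h1 : ∀ ω, ‖T ω‖ ≤ 1) :
    trace μ (fun ω => (LinearMap.ker (T ω).toLinearMap).starProjection) =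
      trace μ (fun ω => (LinearMap.ker (T ω).adjoint.toLinearMap).starProjection) ∧
    IsEquivariant θ (fun ω => (LinearMap.ker (T ω).adjoint.toLinearMap).starProjection) := by
  have hker : ∀ A : ℓ²(Γ, ℂ) →L[ℂ] ℓ²(Γ, ℂ),
      LinearMap.ker (A.adjoint * A).toLinearMap = LinearMap.ker A.toLinearMap := fun A => by
    ext v
    refine ⟨fun hv => ?_, fun hv => ?_⟩
    · have hv' : A.adjoint (A v) = 0 := hv
      have : inner ℂ (A v) (A v) = 0 := by
        rw [← ContinuousLinearMap.adjoint_inner_left, hv', inner_zero_left]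
      exact inner_self_eq_zero.1 this
    · have hv' : A v = 0 := hv
      change A.adjoint (A v) = 0
      rw [hv', map_zero]
  have hproj : ∀ A : ℓ²(Γ, ℂ) →L[ℂ] ℓ²(Γ, ℂ),
      (LinearMap.ker (A.adjoint * A).toLinearMap).starProjection =
        (LinearMap.ker A.toLinearMap).starProjection := fun A => by
    have : ∀ K : Submodule ℂ ℓ²(Γ, ℂ), K = LinearMap.ker A.toLinearMap →
        ∀ [K.HasOrthogonalProjection],
          K.starProjection = (LinearMap.ker A.toLinearMap).starProjection := by
      rintro K rfl _
      rfl
    exact this _ (hker A)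
  have h1' : ∀ ω, ‖(T ω).adjoint‖ ≤ 1 := fun ω => by
    rw [LinearIsometryEquiv.norm_map]
    exact h1 ω
  have hA := mean_ergodic (μ := μ) (hT.adjoint.mul hT)
    (fun ω => norm_one_sub_adjoint_mul_le (h1 ω))
  have hB := mean_ergodic (μ := μ) (hT.adjoint.adjoint.mul hT.adjoint)
    (fun ω => norm_one_sub_adjoint_mul_le (h1' ω))
  simp only [hproj] at hA hB
  simp only [ContinuousLinearMap.adjoint_adjoint] at hB
  refine ⟨tendsto_nhds_unique hA.2 ?_, hB.1⟩
  simp only [trace_one_sub_mul_pow hT.adjoint hT hθ]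
  exact hB.2

/-- Comparison of traces of projections: if `ran P ∩ ker Q = 0` then `tr P ≤ tr Q`. The kernel of
`QP` is then the range of `1 - P`, and the kernel of its adjoint `PQ` contains the range of
`1 - Q`. -/
theorem trace_le_of_range_inf_ker [Countable Γ] {P Q : Ω → ℓ²(Γ, ℂ) →L[ℂ] ℓ²(Γ, ℂ)}
    (hP : IsEquivariant θ P) (hQ : IsEquivariant θ Q) (hP' : ∀ ω, IsStarProjection (P ω))
    (hQ' : ∀ ω, IsStarProjection (Q ω)) (hθ : ∀ g, MeasurePreserving (θ g) μ μ)
    (hPQ : ∀ ω v, P ω v = v → Q ω v = 0 → v = 0) : (trace μ P).re ≤ (trace μ Q).re := by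
  have hn : ∀ ω, ‖Q ω * P ω‖ ≤ 1 := fun ω => (norm_mul_le _ _).trans
    (mul_le_one₀ ((hQ' ω).norm_le) (norm_nonneg _) ((hP' ω).norm_le))
  obtain ⟨h, hE⟩ := (hQ.mul hP).trace_ker_eq_trace_ker_adjoint (μ := μ) hθ hn
  have hk : ∀ ω, (LinearMap.ker (Q ω * P ω).toLinearMap).starProjection = 1 - P ω := by
    intro ω
    have hPP : ∀ v, P ω (P ω v) = P ω v := fun v => by
      rw [← mul_apply_eq_comp, (hP' ω).isIdempotentElem.eq]
    ext1 v
    refine Submodule.eq_starProjection_of_mem_orthogonal ?_ ?_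
    · change Q ω (P ω (v - P ω v)) = 0
      rw [map_sub, hPP, sub_self, map_zero]
    · rw [Submodule.mem_orthogonal]
      intro w hw
      have hw' : P ω w = 0 := hPQ ω _ (hPP w) hw
      change inner ℂ w (v - (v - P ω v)) = 0
      rw [sub_sub_cancel, ← (hP' ω).isSelfAdjoint.inner_apply_comm, hw', inner_zero_left]
  have hle : ∀ ω, (entry (1 - Q ω) 1 1).re ≤
      (entry (LinearMap.ker (Q ω * P ω).adjoint.toLinearMap).starProjection 1 1).re := by
    intro ω
    set K := LinearMap.ker (Q ω * P ω).adjoint.toLinearMap with hK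
    have hQK : ∀ v, K.starProjection (v - Q ω v) = v - Q ω v := fun v => by
      rw [Submodule.starProjection_eq_self_iff]
      change (Q ω * P ω).adjoint (v - Q ω v) = 0
      have : (Q ω * P ω).adjoint = P ω * Q ω := by
        change star (Q ω * P ω) = _
        rw [star_mul, (hQ' ω).isSelfAdjoint.star_eq, (hP' ω).isSelfAdjoint.star_eq]
      rw [this, mul_apply_eq_comp, map_sub, ← mul_apply_eq_comp (Q ω),
        (hQ' ω).isIdempotentElem.eq, sub_self, map_zero]
    have hs := isStarProjection_starProjection (U := K)
    rw [entry_self_re (hQ' ω).one_sub, entry_self_re hs]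
    -- `‖(1 - Q) δ‖² = ⟨(1 - Q) δ, K δ⟩ ≤ ‖(1 - Q) δ‖ ‖K δ‖`.
    set u := (1 - Q ω) (unitVec 1) with hu
    have hu1 : K.starProjection u = u := hQK _
    have h3 : (inner ℂ u u).re = (inner ℂ u (K.starProjection (unitVec 1))).re := by
      rw [← hs.isSelfAdjoint.inner_apply_comm, hu1]
      have : inner ℂ u u = inner ℂ u ((1 - Q ω) (unitVec 1)) := rfl
      rw [this, ← (hQ' ω).one_sub.isSelfAdjoint.inner_apply_comm]
      conv_lhs => rw [hu, ← mul_apply_eq_comp, (hQ' ω).one_sub.isIdempotentElem.eq]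
    have h4 : ‖u‖ ^ 2 ≤ ‖u‖ * ‖K.starProjection (unitVec 1)‖ := by
      rw [← re_inner_self_eq_norm_sq, h3]
      exact (Complex.re_le_norm _).trans (norm_inner_le_norm _ _)
    have h5 : ‖u‖ ≤ ‖K.starProjection (unitVec 1)‖ := by
      rcases (norm_nonneg u).eq_or_lt with h0 | h0
      · rw [← h0]; positivity
      · rw [sq] at h4
        exact le_of_mul_le_mul_left h4 h0
    gcongr
  have hre : ∀ {A : Ω → ℓ²(Γ, ℂ) →L[ℂ] ℓ²(Γ, ℂ)}, IsEquivariant θ A →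
      (trace μ A).re = ∫ ω, (entry (A ω) 1 1).re ∂μ := fun hA =>
    (integral_re (hA.integrable_entry 1 1)).symm
  have h6 : (trace μ (fun ω => 1 - Q ω)).re ≤ (trace μ fun ω =>
      (LinearMap.ker (Q ω * P ω).adjoint.toLinearMap).starProjection).re := by
    rw [hre (one.sub hQ), hre hE]
    exact integral_mono ((one.sub hQ).integrable_entry 1 1).re (hE.integrable_entry 1 1).re hle
  rw [← h] at h6
  simp only [hk] at h6
  rw [trace_sub one hQ, trace_sub one hP, Complex.sub_re, Complex.sub_re] at h6
  linarith

end IsEquivariant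

end Percolation

/-! ### Percolation on a Cayley graph -/

namespace Percolation

open MeasureTheory ProbabilityTheory SimpleGraph

section Translation

variable {Γ : Type*} [Group Γ] {S : Finset Γ}

theorem cayleyGraph_adj_iff (hS : IsCayleyGenerators S) (x y : Γ) :
    (cayleyGraph S).Adj x y ↔ x⁻¹ * y ∈ S := by
  rw [mulCayley_adj']
  constructor
  · rintro ⟨-, g, hg, rfl | rfl⟩
    · simpa using hg
    · simpa using hS.inv_mem g hg
  · intro h
    refine ⟨?_, x⁻¹ * y, h, Or.inl (by group)⟩
    rintro rfl
    exact hS.one_notMem (by simpa using h)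

theorem cayleyGraph_adj_mul_left (g x y : Γ) :
    (cayleyGraph S).Adj (g * x) (g * y) ↔ (cayleyGraph S).Adj x y := by
  simp [mulCayley_adj', mul_assoc]

/-- Left translation by `g` of the vertices (edges) of a Cayley graph. -/
def translateIndex (S : Finset Γ) (g : Γ) : (M : Model) → (Index (cayleyGraph S) M ≃
    Index (cayleyGraph S) M)
  | .site => (Equiv.mulLeft g : Γ ≃ Γ)
  | .bond => SimpleGraph.Iso.mapEdgeSet
    { toEquiv := Equiv.mulLeft g
      map_rel_iff' := cayleyGraph_adj_mul_left g _ _ }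

/-- The translated configuration `θ_g ω = ω(g ·)`. -/
def translate (S : Finset Γ) (M : Model) (g : Γ) (ω : Config (cayleyGraph S) M) :
    Config (cayleyGraph S) M :=
  fun i => ω (translateIndex S g M i)

theorem subgraph_translate_adj (M : Model) (g : Γ) (ω : Config (cayleyGraph S) M) (x y : Γ) :
    (subgraph (cayleyGraph S) M (translate S M g ω)).Adj x y ↔
      (subgraph (cayleyGraph S) M ω).Adj (g * x) (g * y) := by
  cases M
  · simp only [subgraph, Subgraph.induce_adj, Set.mem_ofPred_eq, Subgraph.top_adj,
      cayleyGraph_adj_mul_left]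
    rfl
  · constructor
    · rintro ⟨h, hω⟩
      exact ⟨(cayleyGraph_adj_mul_left g x y).2 h, hω⟩
    · rintro ⟨h, hω⟩
      exact ⟨(cayleyGraph_adj_mul_left g x y).1 h, hω⟩

theorem subgraph_translate_verts (M : Model) (g : Γ) (ω : Config (cayleyGraph S) M) (x : Γ) :
    x ∈ (subgraph (cayleyGraph S) M (translate S M g ω)).verts ↔
      g * x ∈ (subgraph (cayleyGraph S) M ω).verts := by
  cases M
  · rfl
  · constructor
    · rintro ⟨y, h⟩
      exact ⟨g * y, (subgraph_translate_adj .bond g ω x y).1 h⟩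
    · rintro ⟨y, h⟩
      refine ⟨g⁻¹ * y, (subgraph_translate_adj .bond g ω x _).2 ?_⟩
      rw [mul_inv_cancel_left]
      exact h

instance isProbabilityMeasure_law {V : Type*} (G : SimpleGraph V) (M : Model)
    (p : unitInterval) : IsProbabilityMeasure (law G M p) := by
  unfold law
  infer_instance

theorem measurePreserving_translate (M : Model) (p : unitInterval) (g : Γ) :
    MeasurePreserving (translate S M g) (law (cayleyGraph S) M p) (law (cayleyGraph S) M p) := by
  have hm : Measurable (translate S M g) :=
    measurable_pi_lambda _ fun i => measurable_pi_apply (translateIndex S g M i)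
  refine ⟨hm, ?_⟩
  have h := Measure.infinitePi_map_piCongrLeft (X := fun _ : Index (cayleyGraph S) M => Bool)
    (fun _ => bernoulliMeasure true false p) (translateIndex S g M).symm
  conv_rhs => rw [law, ← h]
  rw [law]
  congr 1
  ext ω i
  rw [MeasurableEquiv.coe_piCongrLeft]
  have := Equiv.piCongrLeft_apply_apply (fun _ : Index (cayleyGraph S) M => Bool)
    (translateIndex S g M).symm ω (translateIndex S g M i)
  rw [Equiv.symm_apply_apply] at this
  rw [this]
  rfl

end Translation

section Measurability

variable {V : Type*} (G : SimpleGraph V)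

theorem measurableSet_adj (M : Model) (x y : V) :
    MeasurableSet {ω : Config G M | (subgraph G M ω).Adj x y} := by
  cases M
  · have : {ω : Config G .site | (subgraph G .site ω).Adj x y} =
        {ω | ω x = true} ∩ {ω | ω y = true} ∩ {_ω | G.Adj x y} := by
      ext ω
      simp [subgraph, and_assoc]
    rw [this]
    refine ((?_ : MeasurableSet _).inter ?_).inter (MeasurableSet.const _)
    · exact measurable_pi_apply (X := fun _ : Index G .site => Bool) x
        (measurableSet_singleton true)
    · exact measurable_pi_apply (X := fun _ : Index G .site => Bool) y
        (measurableSet_singleton true)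
  · by_cases h : G.Adj x y
    · have : {ω : Config G .bond | (subgraph G .bond ω).Adj x y} =
          {ω | ω (⟨s(x, y), h⟩ : G.edgeSet) = true} := by
        ext ω
        exact ⟨fun ⟨_, h⟩ => h, fun h' => ⟨h, h'⟩⟩
      rw [this]
      exact measurable_pi_apply (X := fun _ : Index G .bond => Bool) _
        (measurableSet_singleton true)
    · have : {ω : Config G .bond | (subgraph G .bond ω).Adj x y} = ∅ := by
        ext ω
        simpa using fun h' => h ((subgraph G .bond ω).adj_sub h')
      rw [this]
      exact MeasurableSet.empty

theorem measurableSet_verts [Countable V] (M : Model) (x : V) :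
    MeasurableSet {ω : Config G M | x ∈ (subgraph G M ω).verts} := by
  cases M
  · exact measurable_pi_apply (X := fun _ : Index G .site => Bool) x
      (measurableSet_singleton true)
  · have : {ω : Config G .bond | x ∈ (subgraph G .bond ω).verts} =
        ⋃ y, {ω | (subgraph G .bond ω).Adj x y} := by
      ext ω
      simp only [Set.mem_iUnion]
      rfl
    rw [this]
    exact MeasurableSet.iUnion fun y => measurableSet_adj G .bond x y

end Measurability

section RandomOperators

variable {Γ : Type*} [Group Γ] {S : Finset Γ}

theorem deg_le_card (hS : IsCayleyGenerators S) (G' : (cayleyGraph S).Subgraph)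
    (x : G'.verts) : G'.coe.deg x ≤ S.card := by
  rw [deg, ← Set.ncard_coe_finset]
  refine Set.ncard_le_ncard_of_injOn (fun y => (x : Γ)⁻¹ * y) (fun y hy => ?_) ?_
    S.finite_toSet
  · exact (cayleyGraph_adj_iff hS _ _).1 (G'.adj_sub hy)
  · intro y _ z _ h
    exact Subtype.ext (mul_left_cancel h)

open Classical in
theorem ncard_neighborSet (hS : IsCayleyGenerators S) (G' : (cayleyGraph S).Subgraph) (x : Γ) :
    (G'.neighborSet x).ncard = ∑ s ∈ S, if G'.Adj x (x * s) then 1 else 0 := by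
  have h : G'.neighborSet x = (x * ·) '' (S.filter fun s => G'.Adj x (x * s) : Set Γ) := by
    ext y
    simp only [Subgraph.mem_neighborSet, Finset.coe_filter, Set.mem_image, Set.mem_ofPred_eq]
    constructor
    · intro h
      exact ⟨x⁻¹ * y, ⟨(cayleyGraph_adj_iff hS _ _).1 (G'.adj_sub h), by simpa using h⟩, by simp⟩
    · rintro ⟨s, ⟨-, h⟩, rfl⟩
      exact h
  rw [← Finset.card_filter, h, Set.ncard_image_of_injective _ (mul_right_injective x),
    Set.ncard_coe_finset]

variable (S) in
/-- The extension by zero of the percolation Laplacian. -/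
noncomputable abbrev extendedLaplacian (M : Model) (bc : BoundaryCondition)
    (ω : Config (cayleyGraph S) M) : ℓ²(Γ, ℂ) →L[ℂ] ℓ²(Γ, ℂ) :=
  extend _ (laplacian S.card (subgraph (cayleyGraph S) M ω) bc)

variable (M : Model) (bc : BoundaryCondition)

theorem isEquivariant_extend_adjacencyOperator (hS : IsCayleyGenerators S) :
    IsEquivariant (translate S M) (fun ω => extend (subgraph (cayleyGraph S) M ω)
      (subgraph (cayleyGraph S) M ω).coe.adjacencyOperator) := by
  classical
  refine ⟨fun x y => ?_, fun g ω x y => ?_, S.card, fun ω => (norm_extend_le _ _).trans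
    (norm_adjacencyOperator_le _ (deg_le_card hS _))⟩
  · simp only [entry_extend_adjacencyOperator]
    exact Measurable.ite (measurableSet_adj (cayleyGraph S) M x y) measurable_const
      measurable_const
  · rw [entry_extend_adjacencyOperator, entry_extend_adjacencyOperator, subgraph_translate_adj]

theorem isEquivariant_extend_degreeOperator (hS : IsCayleyGenerators S) :
    IsEquivariant (translate S M) (fun ω => extend (subgraph (cayleyGraph S) M ω)
      (subgraph (cayleyGraph S) M ω).coe.degreeOperator) := by
  classical
  refine ⟨fun x y => ?_, fun g ω x y => ?_, S.card, fun ω => (norm_extend_le _ _).trans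
    (norm_degreeOperator_le _ (deg_le_card hS _))⟩
  · simp only [entry_extend_degreeOperator]
    refine Measurable.ite (MeasurableSet.const _) ?_ measurable_const
    simp only [ncard_neighborSet hS, Nat.cast_sum, Nat.cast_ite, Nat.cast_one, Nat.cast_zero]
    exact Finset.measurable_sum _ fun s _ => Measurable.ite
      (measurableSet_adj (cayleyGraph S) M x (x * s)) measurable_const measurable_const
  · rw [entry_extend_degreeOperator, entry_extend_degreeOperator, ncard_neighborSet hS,
      ncard_neighborSet hS]
    simp only [subgraph_translate_adj, mul_assoc, mul_right_inj]

variable [Countable Γ]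

theorem isEquivariant_extend_one :
    IsEquivariant (translate S M) (fun ω => extend (subgraph (cayleyGraph S) M ω) 1) := by
  classical
  refine ⟨fun x y => ?_, fun g ω x y => ?_, 1, fun ω => (norm_extend_le _ _).trans
    ContinuousLinearMap.norm_id_le⟩
  · simp only [entry_extend_one]
    refine Measurable.ite ?_ measurable_const measurable_const
    exact (MeasurableSet.const (x = y)).inter (measurableSet_verts (cayleyGraph S) M x)
  · rw [entry_extend_one, entry_extend_one, subgraph_translate_verts]
    simp

theorem isEquivariant_extendedLaplacian (hS : IsCayleyGenerators S) :
    IsEquivariant (translate S M) (extendedLaplacian S M bc) := by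
  have h1 := isEquivariant_extend_one (S := S) M
  have hA := isEquivariant_extend_adjacencyOperator M hS
  have hD := isEquivariant_extend_degreeOperator M hS
  cases bc
  · convert (h1.smul S.card).sub hA using 2 with ω
    rw [← extend_smul, ← extend_sub]
    rfl
  · convert ((h1.smul (2 * S.card)).sub hD).sub hA using 2 with ω
    rw [← extend_smul, ← extend_sub, ← extend_sub]
    rfl

theorem isEquivariant_extend_polynomial (hS : IsCayleyGenerators S) (q : Polynomial ℂ) :
    IsEquivariant (translate S M) (fun ω => extend (subgraph (cayleyGraph S) M ω)
      (Polynomial.aeval (laplacian S.card (subgraph (cayleyGraph S) M ω) bc) q)) := by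
  have hpow : ∀ n : ℕ, IsEquivariant (translate S M) (fun ω =>
      extend (subgraph (cayleyGraph S) M ω)
        (laplacian S.card (subgraph (cayleyGraph S) M ω) bc ^ n)) := fun n => by
    induction n with
    | zero => simpa only [pow_zero] using isEquivariant_extend_one M
    | succ n ih =>
      simp only [pow_succ, extend_mul]
      exact ih.mul (isEquivariant_extendedLaplacian M bc hS)
  induction q using Polynomial.induction_on' with
  | add p q hp hq =>
    simp only [map_add, extend_add]
    exact hp.add hq
  | monomial n a =>
    convert (hpow n).smul a using 2 with ω
    rw [Polynomial.aeval_monomial, ← extend_smul, Algebra.algebraMap_eq_smul_one, smul_mul_assoc,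
      one_mul]

theorem isEquivariant_extend_spectralProjection (hS : IsCayleyGenerators S) (E : ℝ) :
    IsEquivariant (translate S M) (fun ω => extend (subgraph (cayleyGraph S) M ω)
      (spectralProjection (laplacian S.card (subgraph (cayleyGraph S) M ω) bc) E)) := by
  obtain ⟨q, hq⟩ := exists_polynomial_tendsto_spectralProjection E (4 * S.card)
  refine IsEquivariant.of_tendsto (fun n => isEquivariant_extend_polynomial M bc hS (q n))
    (fun ω x y => ?_) ⟨1, fun ω => (norm_extend_le _ _).trans
      (Submodule.starProjection_norm_le _)⟩
  simp only [entry_extend]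
  exact Filter.Tendsto.inner tendsto_const_nhds (hq _ (isSelfAdjoint_laplacian _ bc)
    (norm_laplacian_le _ (deg_le_card hS _) bc) _)

theorem isStarProjection_extend {V : Type*} {G : SimpleGraph V} (G' : G.Subgraph)
    {P : ℓ²(G'.verts, ℂ) →L[ℂ] ℓ²(G'.verts, ℂ)} (hP : IsStarProjection P) :
    IsStarProjection (extend G' P) := by
  refine ⟨?_, ?_⟩
  · rw [IsIdempotentElem, ← extend_mul, hP.isIdempotentElem.eq]
  · rw [ContinuousLinearMap.isSelfAdjoint_iff', adjoint_extend, hP.isSelfAdjoint.adjoint_eq]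

theorem isStarProjection_spectralProjection {H : Type*} [NormedAddCommGroup H]
    [InnerProductSpace ℂ H] [CompleteSpace H] (T : H →L[ℂ] H) (E : ℝ) :
    IsStarProjection (spectralProjection T E) := isStarProjection_starProjection

/-- The integrated density of states is the trace of the extended spectral projection. -/
theorem ids_eq_trace (hS : IsCayleyGenerators S) (p : unitInterval) (E : ℝ) :
    ids S M p bc E = (trace (law (cayleyGraph S) M p) (fun ω =>
      extend (subgraph (cayleyGraph S) M ω)
        (spectralProjection (laplacian S.card (subgraph (cayleyGraph S) M ω) bc) E))).re := by
  refine Eq.trans ?_ (integral_re ((isEquivariant_extend_spectralProjection M bc hS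
    E).integrable_entry (μ := law (cayleyGraph S) M p) 1 1))
  refine integral_congr_ae (Filter.Eventually.of_forall fun ω => ?_)
  simp only [entry_extend]
  rw [(isStarProjection_spectralProjection _ E).isSelfAdjoint.inner_apply_comm]
  rfl

/-- `Δ^A ≤ Δ^D` implies `N^D ≤ N^A`. The inequality holds in mean only: it is the trace, not the
single expectation value at `δ_1`, that is monotone. -/
theorem ids_dirichlet_le_adjacency (hS : IsCayleyGenerators S) (p : unitInterval) (E : ℝ) :
    ids S M p .dirichlet E ≤ ids S M p .adjacency E := by
  rw [ids_eq_trace _ _ hS, ids_eq_trace _ _ hS]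
  refine IsEquivariant.trace_le_of_range_inf_ker
    (isEquivariant_extend_spectralProjection M .dirichlet hS E)
    (isEquivariant_extend_spectralProjection M .adjacency hS E)
    (fun ω => isStarProjection_extend _ (isStarProjection_spectralProjection _ E))
    (fun ω => isStarProjection_extend _ (isStarProjection_spectralProjection _ E))
    (measurePreserving_translate M p) fun ω v h1 h2 => ?_
  set G' := subgraph (cayleyGraph S) M ω
  rw [extend_apply] at h1 h2
  set w := (inclusion G').toContinuousLinearMap.adjoint v with hw
  have hPw : spectralProjection (laplacian S.card G' .dirichlet) E w = w := by
    conv_rhs => rw [hw, ← h1, adjoint_inclusion_inclusion]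
  have hQw : spectralProjection (laplacian S.card G' .adjacency) E w = 0 :=
    (inclusion G').injective (by rw [h2, map_zero])
  have hw0 := eq_zero_of_spectralProjection (isSelfAdjoint_laplacian G' .adjacency)
    (isSelfAdjoint_laplacian G' .dirichlet)
    (re_inner_adjacency_le_dirichlet G' (deg_le_card hS _)) E hPw hQw
  rw [← h1, hPw, hw0, map_zero]

end RandomOperators

end Percolation

/-! ### Lower bounds by test functions -/

namespace Percolation

open MeasureTheory ProbabilityTheory SimpleGraph

/-- The element of `ℓ²(V)` with values `f` on `F`. -/
noncomputable def testVec {V : Type*} (F : Finset V) (f : V → ℝ) : ℓ²(V, ℂ) :=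
  ∑ x ∈ F, (f x : ℂ) • unitVec x

theorem inner_testVec {V : Type*} (F : Finset V) (f : V → ℝ) (T : ℓ²(V, ℂ) →L[ℂ] ℓ²(V, ℂ)) :
    inner ℂ (testVec F f) (T (testVec F f)) =
      ∑ x ∈ F, ∑ y ∈ F, (f x : ℂ) * f y * entry T x y := by
  simp only [testVec, map_sum, map_smul, sum_inner, inner_sum, inner_smul_left, inner_smul_right,
    Complex.conj_ofReal, entry]
  simp only [Finset.mul_sum]
  rw [Finset.sum_comm]
  exact Finset.sum_congr rfl fun x _ => Finset.sum_congr rfl fun y _ => by ring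

theorem norm_testVec_sq {V : Type*} (F : Finset V) (f : V → ℝ) :
    ‖testVec F f‖ ^ 2 = ∑ x ∈ F, f x ^ 2 := by
  classical
  have h := inner_testVec F f 1
  rw [← re_inner_self_eq_norm_sq]
  change inner ℂ (testVec F f) (testVec F f) = _ at h
  rw [h]
  simp only [entry_eq_apply, one_apply_eq_self, unitVec_apply, mul_ite, mul_one, mul_zero,
    Finset.sum_ite_eq]
  rw [Complex.re_sum]
  refine Finset.sum_congr rfl fun x hx => ?_
  rw [if_pos hx, ← Complex.ofReal_mul, Complex.ofReal_re, sq]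

variable {Γ : Type*} [Group Γ] {S : Finset Γ}

/-- All edges of the Cayley graph that touch `F` are present in `G'`. -/
def ContainsStar (S : Finset Γ) (F : Finset Γ) (G' : (cayleyGraph S).Subgraph) : Prop :=
  ∀ x ∈ F, ∀ s ∈ S, G'.Adj x (x * s)

/-- It takes at most `(|S| + 1) |F|` open vertices or edges to keep all edges that touch `F`. -/
theorem exists_finset_containsStar (hS : IsCayleyGenerators S) (M : Model) (F : Finset Γ) :
    ∃ I : Finset (Index (cayleyGraph S) M), I.card ≤ (S.card + 1) * F.card ∧
      ∀ ω : Config (cayleyGraph S) M, (∀ i ∈ I, ω i = true) →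
        ContainsStar S F (subgraph (cayleyGraph S) M ω) := by
  classical
  have hadj : ∀ x, ∀ s ∈ S, (cayleyGraph S).Adj x (x * s) := fun x s hs =>
    (cayleyGraph_adj_iff hS _ _).2 (by simpa using hs)
  cases M
  · let J : Finset Γ := (F ×ˢ insert 1 S).image fun q => q.1 * q.2
    have hJ : J.card ≤ (S.card + 1) * F.card := by
      refine Finset.card_image_le.trans ?_
      rw [Finset.card_product, mul_comm]
      exact Nat.mul_le_mul_right _ (Finset.card_insert_le _ _)
    refine ⟨J, hJ, fun ω hω x hx s hs => ?_⟩
    have h1 : x ∈ J := Finset.mem_image.2 ⟨(x, 1), by simp [hx], by simp⟩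
    have h2 : x * s ∈ J := Finset.mem_image.2 ⟨(x, s), by simp [hx, hs], rfl⟩
    exact ⟨hω x h1, hω _ h2, hadj x s hs⟩
  · let J : Finset (cayleyGraph S).edgeSet := (F ×ˢ S.attach).image
      fun q : Γ × {s // s ∈ S} => ⟨s(q.1, q.1 * q.2.1), hadj q.1 q.2.1 q.2.2⟩
    have hJ : J.card ≤ (S.card + 1) * F.card := by
      refine Finset.card_image_le.trans ?_
      rw [Finset.card_product, mul_comm, Finset.card_attach]
      exact Nat.mul_le_mul_right _ (Nat.le_succ _)
    have hmem : ∀ x ∈ F, ∀ s, ∀ hs : s ∈ S, ⟨s(x, x * s), hadj x s hs⟩ ∈ J := fun x hx s hs =>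
      Finset.mem_image.2 ⟨(x, ⟨s, hs⟩), by simp [hx], rfl⟩
    exact ⟨J, hJ, fun ω hω x hx s hs => ⟨hadj x s hs, hω _ (hmem x hx s hs)⟩⟩

theorem law_real_forall_open {V : Type*} (G : SimpleGraph V) (M : Model) (p : unitInterval)
    (I : Finset (Index G M)) :
    (law G M p).real {ω | ∀ i ∈ I, ω i = true} = (p : ℝ) ^ I.card := by
  have h : {ω : Config G M | ∀ i ∈ I, ω i = true} =
      (I : Set (Index G M)).pi (fun _ => {true}) := by
    ext ω
    simp [Set.mem_pi]
  rw [measureReal_def, h, law, Measure.infinitePi_pi _ (fun _ _ => measurableSet_singleton _),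
    Finset.prod_const, ENNReal.toReal_pow, ← measureReal_def,
    bernoulliMeasure_real_apply _ (measurableSet_singleton _)]
  simp

section Deterministic

variable {F : Finset Γ} {f : Γ → ℝ} {G' : (cayleyGraph S).Subgraph}

theorem inclusion_adjoint_testVec (hF : ∀ x ∈ F, x ∈ G'.verts) :
    inclusion G' ((inclusion G').toContinuousLinearMap.adjoint (testVec F f)) = testVec F f := by
  simp only [testVec, map_sum, map_smul]
  refine Finset.sum_congr rfl fun x hx => ?_
  have h : unitVec x = inclusion G' (unitVec ⟨x, hF x hx⟩) :=
    (inclusion_unitVec G' ⟨x, hF x hx⟩).symm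
  rw [h, adjoint_inclusion_inclusion]

open Classical in
/-- In a row `x ∈ F` the Dirichlet Laplacian has the entries of `k - A` on the full Cayley graph. -/
theorem entry_extend_dirichlet (hS : IsCayleyGenerators S) (hF : ContainsStar S F G')
    (hF' : ∀ x ∈ F, x ∈ G'.verts) {x y : Γ} (hx : x ∈ F) :
    entry (extend G' (laplacian S.card G' .dirichlet)) x y =
      (if x = y then (S.card : ℂ) else 0) - if x⁻¹ * y ∈ S then 1 else 0 := by
  have h1 : entry (extend G' (laplacian S.card G' .dirichlet)) x y =
      2 * S.card * entry (extend G' 1) x y - entry (extend G' G'.coe.degreeOperator) x y -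
        entry (extend G' G'.coe.adjacencyOperator) x y := by
    simp only [laplacian, extend_sub, extend_smul, entry, sub_apply, smul_apply, inner_sub_right,
      inner_smul_right]
  have hdeg : (G'.neighborSet x).ncard = S.card := by
    rw [ncard_neighborSet hS, Finset.sum_congr rfl fun s hs => if_pos (hF x hx s hs)]
    simp
  have hadj : G'.Adj x y ↔ x⁻¹ * y ∈ S := by
    refine ⟨fun h => (cayleyGraph_adj_iff hS _ _).1 (G'.adj_sub h), fun h => ?_⟩
    have := hF x hx _ h
    rwa [mul_inv_cancel_left] at this
  rw [h1, entry_extend_one, entry_extend_degreeOperator, entry_extend_adjacencyOperator, hdeg]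
  simp only [hadj, hF' x hx, and_true]
  by_cases hxy : x = y
  · simp only [if_pos hxy]
    ring
  · simp only [if_neg hxy]
    ring

/-- Where all edges at the support of `f` are present, the Dirichlet Laplacian has the quadratic
form of the full Cayley graph. -/
theorem re_inner_dirichlet_testVec (hS : IsCayleyGenerators S) (hF : ContainsStar S F G')
    (hF' : ∀ x ∈ F, x ∈ G'.verts) (hf : ∀ x, x ∉ F → f x = 0) :
    (inner ℂ (testVec F f)
      (extend G' (laplacian S.card G' .dirichlet) (testVec F f))).re =
      S.card * ∑ x ∈ F, f x ^ 2 - ∑ x ∈ F, ∑ s ∈ S, f x * f (x * s) := by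
  classical
  rw [inner_testVec, Finset.sum_congr rfl fun x hx => Finset.sum_congr rfl fun y _ => by
    rw [entry_extend_dirichlet hS hF hF' hx], Complex.re_sum, Finset.mul_sum,
    ← Finset.sum_sub_distrib]
  refine Finset.sum_congr rfl fun x hx => ?_
  have hsum : ∑ y ∈ F, f x * f y * (if x⁻¹ * y ∈ S then 1 else 0) =
      ∑ s ∈ S, f x * f (x * s) := by
    simp only [mul_ite, mul_one, mul_zero, ← Finset.sum_filter]
    rw [← Finset.sum_filter_of_ne (s := S) (p := fun s => x * s ∈ F)
      (f := fun s => f x * f (x * s)) fun s _ h => by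
        by_contra h'
        exact h (by rw [hf _ h', mul_zero])]
    refine Finset.sum_nbij' (fun y => x⁻¹ * y) (fun s => x * s) ?_ ?_ ?_ ?_ ?_
    · intro y hy
      simpa [and_comm] using hy
    · intro s hs
      simpa [and_comm] using hs
    · simp
    · simp
    · simp
  rw [← hsum]
  have hterm : ∀ y, (f x : ℂ) * f y * ((if x = y then (S.card : ℂ) else 0) -
      if x⁻¹ * y ∈ S then 1 else 0) = (((if x = y then S.card * f x ^ 2 else 0) -
        f x * f y * (if x⁻¹ * y ∈ S then 1 else 0) : ℝ) : ℂ) := by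
    intro y
    by_cases hxy : x = y
    · subst hxy
      split_ifs <;> push_cast <;> ring
    · simp only [if_neg hxy]
      split_ifs <;> push_cast <;> ring
  simp only [hterm]
  rw [← Complex.ofReal_sum, Complex.ofReal_re, Finset.sum_sub_distrib]
  simp [hx]

/-- A test function of small Rayleigh quotient forces spectral mass on its support. -/
theorem half_le_sum_entry (hS : IsCayleyGenerators S) (hF : ContainsStar S F G')
    (hF' : ∀ x ∈ F, x ∈ G'.verts) (hf : ∀ x, x ∉ F → f x = 0) {E : ℝ} (hE : 0 < E)
    (hf0 : 0 < ∑ x ∈ F, f x ^ 2)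
    (hR : S.card * ∑ x ∈ F, f x ^ 2 - ∑ x ∈ F, ∑ s ∈ S, f x * f (x * s) ≤
      E / 2 * ∑ x ∈ F, f x ^ 2) :
    1 / 2 ≤ ∑ x ∈ F, (entry (extend G'
      (spectralProjection (laplacian S.card G' .dirichlet) E)) x x).re := by
  set L := laplacian S.card G' .dirichlet with hL
  set w := (inclusion G').toContinuousLinearMap.adjoint (testVec F f) with hw
  have hnw : ‖w‖ = ‖testVec F f‖ := by
    rw [← inclusion_adjoint_testVec hF', LinearIsometry.norm_map]
  have hpos : ∀ v, 0 ≤ (inner ℂ (L v) v).re := fun v =>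
    (re_inner_adjacency_nonneg G' (deg_le_card hS G') v).trans
      (re_inner_adjacency_le_dirichlet G' (deg_le_card hS G') v)
  have hray : (inner ℂ (L w) w).re ≤ E / 2 * ‖w‖ ^ 2 := by
    have h := re_inner_dirichlet_testVec hS hF hF' hf
    rw [hnw, norm_testVec_sq]
    refine le_trans (le_of_eq ?_) hR
    rw [← h, extend_apply, (isSelfAdjoint_laplacian G' .dirichlet).inner_apply_comm, hw,
      ContinuousLinearMap.adjoint_inner_left]
    rfl
  have h1 := half_le_norm_spectralProjection_sq (isSelfAdjoint_laplacian G' .dirichlet) hpos hE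
    hray
  set P := extend G' (spectralProjection L E) with hP
  have hPs : IsStarProjection P :=
    isStarProjection_extend G' (isStarProjection_spectralProjection L E)
  have h2 : ‖P (testVec F f)‖ = ‖spectralProjection L E w‖ := by
    rw [hP, extend_apply, LinearIsometry.norm_map]
  have h3 : ‖P (testVec F f)‖ ≤ ∑ x ∈ F, |f x| * ‖P (unitVec x)‖ := by
    rw [testVec, map_sum]
    refine norm_sum_le_of_le _ fun x _ => ?_
    rw [map_smul, norm_smul, Complex.norm_real, Real.norm_eq_abs]
  have h4 : ‖P (testVec F f)‖ ^ 2 ≤ (∑ x ∈ F, f x ^ 2) * ∑ x ∈ F, ‖P (unitVec x)‖ ^ 2 := by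
    calc ‖P (testVec F f)‖ ^ 2 ≤ (∑ x ∈ F, |f x| * ‖P (unitVec x)‖) ^ 2 := by gcongr
      _ ≤ (∑ x ∈ F, |f x| ^ 2) * ∑ x ∈ F, ‖P (unitVec x)‖ ^ 2 :=
        Finset.sum_mul_sq_le_sq_mul_sq _ _ _
      _ = _ := by simp only [sq_abs]
  rw [hnw, norm_testVec_sq, ← h2] at h1
  have h5 : (∑ x ∈ F, f x ^ 2) * (1 / 2) ≤ (∑ x ∈ F, f x ^ 2) * ∑ x ∈ F, ‖P (unitVec x)‖ ^ 2 := by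
    linarith
  simp only [entry_self_re hPs]
  exact le_of_mul_le_mul_left h5 hf0

end Deterministic

/-- A test function with Rayleigh quotient at most `E / 2` on a finite set `F` bounds the
integrated density of states from below: with probability `p ^ ((|S| + 1) |F|)` all edges at `F`
are present, and then the spectral projection has trace at least `1 / 2` on `F`. -/
theorem le_ids_dirichlet [Countable Γ] (hS : IsCayleyGenerators S) (hS0 : S.Nonempty) (M : Model)
    (p : unitInterval) {F : Finset Γ} {f : Γ → ℝ} (hf : ∀ x, x ∉ F → f x = 0) {E : ℝ}
    (hE : 0 < E) (hf0 : 0 < ∑ x ∈ F, f x ^ 2)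
    (hR : S.card * ∑ x ∈ F, f x ^ 2 - ∑ x ∈ F, ∑ s ∈ S, f x * f (x * s) ≤
      E / 2 * ∑ x ∈ F, f x ^ 2) :
    (p : ℝ) ^ ((S.card + 1) * F.card) / (2 * F.card) ≤ ids S M p .dirichlet E := by
  set μ := law (cayleyGraph S) M p with hμ
  set P : Config (cayleyGraph S) M → ℓ²(Γ, ℂ) →L[ℂ] ℓ²(Γ, ℂ) := fun ω =>
    extend (subgraph (cayleyGraph S) M ω) (spectralProjection
      (laplacian S.card (subgraph (cayleyGraph S) M ω) .dirichlet) E) with hP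
  have hPE : IsEquivariant (translate S M) P :=
    isEquivariant_extend_spectralProjection M .dirichlet hS E
  have hPs : ∀ ω, IsStarProjection (P ω) := fun ω =>
    isStarProjection_extend _ (isStarProjection_spectralProjection _ E)
  have hint : ∀ x, Integrable (fun ω => (entry (P ω) x x).re) μ := fun x =>
    (hPE.integrable_entry x x).re
  have hids : ∀ x, ∫ ω, (entry (P ω) x x).re ∂μ = ids S M p .dirichlet E := fun x => by
    rw [ids_eq_trace M .dirichlet hS,
      ← hPE.integral_entry_self (measurePreserving_translate M p) x]
    exact integral_re (hPE.integrable_entry x x)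
  have hsum : ∫ ω, ∑ x ∈ F, (entry (P ω) x x).re ∂μ = F.card * ids S M p .dirichlet E := by
    rw [integral_finsetSum F fun x _ => hint x, Finset.sum_congr rfl fun x _ => hids x]
    simp
  obtain ⟨I, hI, hIω⟩ := exists_finset_containsStar hS M F
  have hmarkov := mul_meas_ge_le_integral_of_nonneg (μ := μ)
    (f := fun ω => ∑ x ∈ F, (entry (P ω) x x).re)
    (Filter.Eventually.of_forall fun ω => Finset.sum_nonneg fun x _ => by
      rw [entry_self_re (hPs ω)]
      positivity) (integrable_finsetSum F fun x _ => hint x) (1 / 2)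
  have hsub : {ω : Config (cayleyGraph S) M | ∀ i ∈ I, ω i = true} ⊆
      {ω | 1 / 2 ≤ ∑ x ∈ F, (entry (P ω) x x).re} := by
    intro ω hω
    have hstar := hIω ω hω
    obtain ⟨s, hs⟩ := hS0
    exact half_le_sum_entry hS hstar (fun x hx => (hstar x hx s hs).fst_mem) hf hE hf0 hR
  have hprob : (p : ℝ) ^ ((S.card + 1) * F.card) ≤
      μ.real {ω | 1 / 2 ≤ ∑ x ∈ F, (entry (P ω) x x).re} := by
    refine le_trans ?_ (measureReal_mono hsub)
    rw [hμ, law_real_forall_open]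
    exact pow_le_pow_of_le_one p.2.1 p.2.2 hI
  have hF0 : 0 < F.card := by
    rw [Finset.card_pos]
    by_contra h
    rw [Finset.not_nonempty_iff_eq_empty] at h
    simp [h] at hf0
  have hF0' : (0 : ℝ) < F.card := by exact_mod_cast hF0
  rw [hsum] at hmarkov
  rw [div_le_iff₀ (by positivity)]
  linarith

/-- Summation by parts on a group: for finitely supported `f`,
`∑_x f(x)² - ∑_x f(x) f(xs) = ½ ∑_x (f(x) - f(xs))²`. -/
theorem sum_sq_sub_sum_mul {F F' : Finset Γ} {f : Γ → ℝ} (hf : ∀ x, x ∉ F → f x = 0) (s : Γ)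
    (hF' : ∀ x, x ∉ F' → f x = f (x * s)) :
    ∑ x ∈ F, f x ^ 2 - ∑ x ∈ F, f x * f (x * s) =
      1 / 2 * ∑ x ∈ F', (f x - f (x * s)) ^ 2 := by
  have h1 : HasSum (fun x => f x ^ 2) (∑ x ∈ F, f x ^ 2) :=
    hasSum_sum_of_ne_finset_zero fun x hx => by rw [hf x hx]; ring
  have h2 : HasSum (fun x => f (x * s) ^ 2) (∑ x ∈ F, f x ^ 2) :=
    (Equiv.mulRight s).hasSum_iff (f := fun x => f x ^ 2).2 h1
  have h3 : HasSum (fun x => f x * f (x * s)) (∑ x ∈ F, f x * f (x * s)) :=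
    hasSum_sum_of_ne_finset_zero fun x hx => by rw [hf x hx]; ring
  have h4 : HasSum (fun x => (f x - f (x * s)) ^ 2) (∑ x ∈ F', (f x - f (x * s)) ^ 2) :=
    hasSum_sum_of_ne_finset_zero fun x hx => by rw [hF' x hx]; ring
  have h5 := (h1.add h2).sub (h3.mul_left 2)
  have e : (fun x => (f x - f (x * s)) ^ 2) =
      fun x => f x ^ 2 + f (x * s) ^ 2 - 2 * (f x * f (x * s)) := by
    funext x
    ring
  rw [← e] at h5
  have h6 := h4.unique h5
  linarith

end Percolation

/-! ### The lamplighter group -/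

namespace Lamplighter

variable {m : ℕ}

/-- A lamplighter element is a pair of a lamp configuration and a position. -/
def prodEquiv (m : ℕ) : (ℤ →₀ ZMod m) × ℤ ≃ Lamplighter m where
  toFun q := ⟨q.1, q.2⟩
  invFun g := (g.lamps, g.pos)
  left_inv _ := rfl
  right_inv _ := rfl

instance [NeZero m] : Countable (Lamplighter m) := (prodEquiv m).symm.injective.countable

section Generators

/-- The pure translations are powers of the generator `(0, 1)`. -/
theorem mk_zero_mem_closure [NeZero m] (z : ℤ) :
    (⟨0, z⟩ : Lamplighter m) ∈ Subgroup.closure (naturalGenerators m : Set (Lamplighter m)) := by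
  have h1 : (⟨0, 1⟩ : Lamplighter m) ∈
      Subgroup.closure (naturalGenerators m : Set (Lamplighter m)) := by
    refine Subgroup.subset_closure ?_
    simp only [naturalGenerators, Finset.coe_union, Finset.coe_image, Finset.coe_univ]
    exact Or.inl ⟨0, trivial, by simp⟩
  have h2 : ∀ n : ℤ, (⟨0, n⟩ : Lamplighter m) = ⟨0, 1⟩ ^ n := by
    intro n
    induction n using Int.induction_on with
    | zero => rfl
    | succ n ih =>
      rw [zpow_add_one, ← ih]
      ext <;> simp
    | pred n ih =>
      rw [zpow_sub_one, ← ih]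
      ext <;> simp [sub_eq_add_neg]
  rw [h2]
  exact Subgroup.zpow_mem _ h1 _

theorem isCayleyGenerators_naturalGenerators (m : ℕ) [NeZero m] :
    Percolation.IsCayleyGenerators (naturalGenerators m) := by
  refine ⟨fun s hs => ?_, fun h => ?_, ?_⟩
  · simp only [naturalGenerators, Finset.mem_union, Finset.mem_image, Finset.mem_univ,
      true_and] at hs ⊢
    rcases hs with ⟨l, rfl⟩ | ⟨l, rfl⟩
    · refine Or.inr ⟨-l, ?_⟩
      ext z
      · simp [Finsupp.single_apply, eq_comm]
      · simp
    · refine Or.inl ⟨-l, ?_⟩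
      ext z
      · simp [Finsupp.single_apply, eq_sub_iff_add_eq]
      · simp
  · simp only [naturalGenerators, Finset.mem_union, Finset.mem_image, Finset.mem_univ,
      true_and] at h
    rcases h with ⟨l, h⟩ | ⟨l, h⟩ <;> simpa using congrArg pos h
  · set K := Subgroup.closure (naturalGenerators m : Set (Lamplighter m)) with hK
    have h1 : ∀ l : ZMod m, (⟨Finsupp.single 1 l, 1⟩ : Lamplighter m) ∈ K := fun l => by
      refine Subgroup.subset_closure ?_
      simp only [naturalGenerators, Finset.coe_union, Finset.coe_image, Finset.coe_univ]
      exact Or.inl ⟨l, trivial, rfl⟩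
    -- `(l δ₁, 1) (0, -1) = (l δ₁, 0)`, and conjugation by `(0, z - 1)` moves the
    -- lamp from `1` to `z`.
    have h2 : ∀ (z : ℤ) (l : ZMod m), (⟨Finsupp.single z l, 0⟩ : Lamplighter m) ∈ K := by
      intro z l
      have e : (⟨Finsupp.single z l, 0⟩ : Lamplighter m) =
          ⟨0, z - 1⟩ * ⟨Finsupp.single 1 l, 1⟩ * ⟨0, -z⟩ := by
        ext w
        · simp [Finsupp.single_apply, eq_sub_iff_add_eq]
        · simp
      rw [e]
      exact K.mul_mem (K.mul_mem (mk_zero_mem_closure _) (h1 l)) (mk_zero_mem_closure _)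
    have h3 : ∀ φ : ℤ →₀ ZMod m, (⟨φ, 0⟩ : Lamplighter m) ∈ K := by
      intro φ
      induction φ using Finsupp.induction_linear with
      | zero => exact mk_zero_mem_closure 0
      | add φ ψ hφ hψ =>
        have e : (⟨φ + ψ, 0⟩ : Lamplighter m) = ⟨φ, 0⟩ * ⟨ψ, 0⟩ := by
          ext w <;> simp
        rw [e]
        exact K.mul_mem hφ hψ
      | single z l => exact h2 z l
    rw [eq_top_iff]
    intro g _
    have e : g = ⟨g.lamps, 0⟩ * ⟨0, g.pos⟩ := by
      ext w <;> simp
    rw [e]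
    exact K.mul_mem (h3 _) (mk_zero_mem_closure _)

end Generators

theorem nonempty_of_isCayleyGenerators {S : Finset (Lamplighter m)}
    (hS : Percolation.IsCayleyGenerators S) : S.Nonempty := by
  by_contra h
  rw [Finset.not_nonempty_iff_eq_empty] at h
  have h1 := hS.closure_eq_top
  rw [h, Finset.coe_empty, Subgroup.closure_empty] at h1
  have h2 : (⟨0, 1⟩ : Lamplighter m) ∈ (⊥ : Subgroup (Lamplighter m)) := by
    rw [h1]
    trivial
  simpa using congrArg pos (Subgroup.mem_bot.1 h2)

section TestFunction

variable [NeZero m]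

/-- The lamp configurations supported in `[-N, N]`. -/
noncomputable def box (m : ℕ) [NeZero m] (N : ℕ) : Finset (ℤ →₀ ZMod m) :=
  (Finset.Icc (-(N : ℤ)) N).finsupp fun _ => Finset.univ

theorem mem_box {N : ℕ} {φ : ℤ →₀ ZMod m} : φ ∈ box m N ↔ ∀ z, (N : ℤ) < |z| → φ z = 0 := by
  rw [box, Finset.mem_finsupp_iff]
  simp only [Finset.mem_univ, implies_true, and_true, Finset.subset_iff, Finsupp.mem_support_iff,
    Finset.mem_Icc, ← abs_le]
  exact forall_congr' fun z => by rw [← not_lt, not_imp_not]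

theorem card_box (N : ℕ) : (box m N).card = m ^ (2 * N + 1) := by
  rw [box, Finset.card_finsupp]
  simp only [Finset.card_univ, ZMod.card, Finset.prod_const, Int.card_Icc]
  congr 1
  omega

/-- The elements with lamps in `[-N, N]` and position in `[-n, n]`. -/
noncomputable def tower (m : ℕ) [NeZero m] (N n : ℕ) : Finset (Lamplighter m) :=
  (box m N ×ˢ Finset.Icc (-(n : ℤ)) n).map (prodEquiv m).toEmbedding

theorem mem_tower {N n : ℕ} {g : Lamplighter m} :
    g ∈ tower m N n ↔ g.lamps ∈ box m N ∧ |g.pos| ≤ n := by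
  rw [tower, Finset.mem_map_equiv, Finset.mem_product, Finset.mem_Icc, ← abs_le]
  rfl

theorem card_tower (N n : ℕ) : (tower m N n).card = m ^ (2 * N + 1) * (2 * n + 1) := by
  rw [tower, Finset.card_map, Finset.card_product, card_box, Int.card_Icc]
  congr 1
  omega

open Classical in
/-- The tent function `(n - |x|)₊` of the position on the elements with lamps in `[-N, N]`. -/
noncomputable def tent (N n : ℕ) (g : Lamplighter m) : ℝ :=
  if g.lamps ∈ box m N then max ((n : ℝ) - |(g.pos : ℝ)|) 0 else 0

theorem tent_eq_zero {N n : ℕ} {g : Lamplighter m} (hg : g ∉ tower m N n) : tent N n g = 0 := by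
  rw [tent]
  split_ifs with h
  · have h1 : ¬ |g.pos| ≤ n := fun h' => hg (mem_tower.2 ⟨h, h'⟩)
    refine max_eq_right (sub_nonpos.2 ?_)
    have h2 : (n : ℤ) ≤ |g.pos| := by omega
    exact_mod_cast h2
  · rfl

theorem abs_max_sub_max_le (a b c : ℝ) : |max (c - |a|) 0 - max (c - |b|) 0| ≤ |a - b| := by
  refine (abs_max_sub_max_le_abs _ _ _).trans ?_
  rw [sub_sub_sub_cancel_left, abs_sub_comm]
  exact abs_abs_sub_abs_le_abs_sub a b

/-- Right multiplication by an element of reach `r` changes the tent function by at most `r`, and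
only on a slightly larger tower: it moves the position by at most `r` and, as long as the position is
within `[-(n + r), n + r]`, does not touch the lamps outside `[-(n + 2r), n + 2r]`. -/
theorem abs_tent_sub_le {r n : ℕ} {s : Lamplighter m} (hs : |s.pos| ≤ r)
    (hs' : s.lamps ∈ box m r) (g : Lamplighter m) :
    |tent (n + 2 * r) n g - tent (n + 2 * r) n (g * s)| ≤ r ∧
      (g ∉ tower m (n + 2 * r) (n + r) →
        tent (n + 2 * r) n g = tent (n + 2 * r) n (g * s)) := by
  have hfar : ∀ g' : Lamplighter m, (n : ℤ) ≤ |g'.pos| → tent (n + 2 * r) n g' = 0 := by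
    intro g' hg'
    rw [tent]
    split_ifs with h
    · refine max_eq_right (sub_nonpos.2 ?_)
      exact_mod_cast hg'
    · rfl
  have hpos : (g * s).pos = g.pos + s.pos := rfl
  by_cases hg : |g.pos| ≤ n + r
  · have hbox : (g * s).lamps ∈ box m (n + 2 * r) ↔ g.lamps ∈ box m (n + 2 * r) := by
      rw [mem_box, mem_box]
      refine forall_congr' fun z => imp_congr_right fun hz => ?_
      have h0 : s.lamps (z - g.pos) = 0 := by
        refine mem_box.1 hs' _ ?_
        have := abs_sub_abs_le_abs_sub z g.pos
        push_cast at hz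
        linarith
      rw [mul_lamps, Finsupp.add_apply, shift_apply, h0, add_zero]
    refine ⟨?_, fun h => ?_⟩
    · rw [tent, tent]
      simp only [hbox]
      split_ifs with h
      · refine (abs_max_sub_max_le _ _ _).trans ?_
        rw [hpos]
        push_cast
        rw [sub_add_cancel_left, abs_neg]
        exact_mod_cast hs
      · simp
    · have h' : g.lamps ∉ box m (n + 2 * r) := fun h' => h (mem_tower.2 ⟨h', by exact_mod_cast hg⟩)
      rw [tent, tent, if_neg h', if_neg fun h => h' (hbox.1 h)]
  · have h1 : (n : ℤ) ≤ |(g * s).pos| := by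
      have := abs_sub_abs_le_abs_sub g.pos (-s.pos)
      rw [abs_neg, sub_neg_eq_add] at this
      rw [hpos]
      linarith
    have h2 : (n : ℤ) ≤ |g.pos| := by linarith
    rw [hfar _ h1, hfar _ h2]
    simp

/-- The tent of height `2j` is at least `j` at the `j` positions `1, …, j`. -/
theorem pow_three_le_sum_tent_sq (N j : ℕ) :
    (m : ℝ) ^ (2 * N + 1) * (j : ℝ) ^ 3 ≤ ∑ g ∈ tower m N (2 * j), tent N (2 * j) g ^ 2 := by
  have hinner : (j : ℝ) ^ 3 ≤ ∑ x ∈ Finset.Icc (-((2 * j : ℕ) : ℤ)) ((2 * j : ℕ) : ℤ),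
      (max (((2 * j : ℕ) : ℝ) - |(x : ℝ)|) 0) ^ 2 := by
    calc (j : ℝ) ^ 3 = ∑ _x ∈ Finset.Icc (1 : ℤ) j, (j : ℝ) ^ 2 := by
          simp
          ring
      _ ≤ ∑ x ∈ Finset.Icc (1 : ℤ) j, (max (((2 * j : ℕ) : ℝ) - |(x : ℝ)|) 0) ^ 2 := by
          refine Finset.sum_le_sum fun x hx => ?_
          rw [Finset.mem_Icc] at hx
          have h1 : (1 : ℝ) ≤ x := by exact_mod_cast hx.1
          have h2 : (x : ℝ) ≤ j := by exact_mod_cast hx.2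
          gcongr
          refine le_max_of_le_left ?_
          rw [abs_of_nonneg (by linarith)]
          push_cast
          linarith
      _ ≤ _ := by
          refine Finset.sum_le_sum_of_subset_of_nonneg ?_ fun _ _ _ => by positivity
          refine Finset.Icc_subset_Icc ?_ ?_ <;> push_cast <;> linarith
  rw [tower, Finset.sum_map, Finset.sum_product]
  calc (m : ℝ) ^ (2 * N + 1) * (j : ℝ) ^ 3 = ∑ _φ ∈ box m N, (j : ℝ) ^ 3 := by
        rw [Finset.sum_const, card_box, nsmul_eq_mul]
        push_cast
        ring
    _ ≤ _ := by
        refine Finset.sum_le_sum fun φ hφ => hinner.trans (le_of_eq ?_)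
        refine Finset.sum_congr rfl fun x _ => ?_
        have : tent N (2 * j) ((prodEquiv m).toEmbedding (φ, x)) =
            max (((2 * j : ℕ) : ℝ) - |(x : ℝ)|) 0 := if_pos hφ
        rw [this]

/-- A common bound for the displacements and the lamp supports of finitely many elements. -/
theorem exists_reach (S : Finset (Lamplighter m)) :
    ∃ r : ℕ, 1 ≤ r ∧ ∀ s ∈ S, |s.pos| ≤ r ∧ s.lamps ∈ box m r := by
  classical
  induction S using Finset.induction_on with
  | empty => exact ⟨1, le_rfl, by simp⟩
  | insert s S hs ih =>
    obtain ⟨r, hr, hS⟩ := ih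
    set R : ℕ := r + s.pos.natAbs + ∑ z ∈ s.lamps.support, z.natAbs with hR
    refine ⟨R, by omega, fun t ht => ?_⟩
    rcases Finset.mem_insert.1 ht with rfl | ht
    · have hp := Int.natCast_natAbs t.pos
      refine ⟨by omega, mem_box.2 fun z hz => ?_⟩
      by_contra h
      have : z.natAbs ≤ ∑ z ∈ t.lamps.support, z.natAbs :=
        Finset.single_le_sum (f := fun z : ℤ => z.natAbs) (fun _ _ => Nat.zero_le _)
          (Finsupp.mem_support_iff.2 h)
      have hz' := Int.natCast_natAbs z
      omega
    · obtain ⟨h1, h2⟩ := hS t ht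
      refine ⟨by omega, mem_box.2 fun z hz => mem_box.1 h2 z ?_⟩
      omega

end TestFunction

end Lamplighter

namespace Percolation

open Lamplighter

/-- The Rayleigh quotient of the tent function of height `2j` is `O(j⁻²)`. -/
theorem rayleigh_tent {m : ℕ} [NeZero m] {S : Finset (Lamplighter m)} {r j : ℕ} (hr : 1 ≤ r)
    (hS : ∀ s ∈ S, |s.pos| ≤ r ∧ s.lamps ∈ box m r) (hj : r ≤ j) {E : ℝ}
    (hE : 7 * S.card * (r : ℝ) ^ 2 ≤ E * (j : ℝ) ^ 2) :
    S.card * ∑ x ∈ tower m (2 * j + 2 * r) (2 * j), tent (2 * j + 2 * r) (2 * j) x ^ 2 -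
      ∑ x ∈ tower m (2 * j + 2 * r) (2 * j), ∑ s ∈ S,
        tent (2 * j + 2 * r) (2 * j) x * tent (2 * j + 2 * r) (2 * j) (x * s) ≤
      E / 2 * ∑ x ∈ tower m (2 * j + 2 * r) (2 * j), tent (2 * j + 2 * r) (2 * j) x ^ 2 := by
  set N := 2 * j + 2 * r with hN
  set f : Lamplighter m → ℝ := tent N (2 * j) with hf
  have hr' : (1 : ℝ) ≤ r := by exact_mod_cast hr
  have hj' : (r : ℝ) ≤ j := by exact_mod_cast hj
  have hj0 : (0 : ℝ) < j := by linarith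
  have hE0 : 0 ≤ E := by
    by_contra h
    have h1 : E * (j : ℝ) ^ 2 < 0 := mul_neg_of_neg_of_pos (not_le.1 h) (by positivity)
    have h2 : 0 ≤ 7 * S.card * (r : ℝ) ^ 2 := by positivity
    linarith
  have hs : ∀ s ∈ S, ∑ x ∈ tower m N (2 * j), f x ^ 2 -
      ∑ x ∈ tower m N (2 * j), f x * f (x * s) ≤
        1 / 2 * ((m : ℝ) ^ (2 * N + 1) * (7 * j) * (r : ℝ) ^ 2) := by
    intro s hs
    obtain ⟨h1, h2⟩ := hS s hs
    have h3 := fun g => abs_tent_sub_le (n := 2 * j) h1 h2 g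
    rw [sum_sq_sub_sum_mul (F' := tower m N (2 * j + r)) (fun x hx => tent_eq_zero hx) s
      fun x hx => (h3 x).2 hx]
    have h4 : ∑ x ∈ tower m N (2 * j + r), (f x - f (x * s)) ^ 2 ≤
        (tower m N (2 * j + r)).card * (r : ℝ) ^ 2 := by
      rw [← nsmul_eq_mul]
      refine Finset.sum_le_card_nsmul _ _ _ fun x _ => ?_
      rw [← sq_abs]
      have := (h3 x).1
      gcongr
    refine mul_le_mul_of_nonneg_left (h4.trans ?_) (by norm_num)
    rw [card_tower]
    push_cast
    gcongr
    linarith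
  have h5 : S.card * ∑ x ∈ tower m N (2 * j), f x ^ 2 -
      ∑ x ∈ tower m N (2 * j), ∑ s ∈ S, f x * f (x * s) =
      ∑ s ∈ S, (∑ x ∈ tower m N (2 * j), f x ^ 2 -
        ∑ x ∈ tower m N (2 * j), f x * f (x * s)) := by
    rw [Finset.sum_sub_distrib, Finset.sum_comm, Finset.sum_const, nsmul_eq_mul]
  rw [h5]
  calc _ ≤ S.card • (1 / 2 * ((m : ℝ) ^ (2 * N + 1) * (7 * j) * (r : ℝ) ^ 2)) :=
        Finset.sum_le_card_nsmul _ _ _ hs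
    _ = (7 * S.card * (r : ℝ) ^ 2) * ((m : ℝ) ^ (2 * N + 1) * j / 2) := by
        rw [nsmul_eq_mul]
        ring
    _ ≤ (E * (j : ℝ) ^ 2) * ((m : ℝ) ^ (2 * N + 1) * j / 2) := by gcongr
    _ = E / 2 * ((m : ℝ) ^ (2 * N + 1) * (j : ℝ) ^ 3) := by ring
    _ ≤ _ := by
        gcongr
        exact pow_three_le_sum_tent_sq N j

theorem exp_neg_le_pow_div {p : ℝ} (hp : 0 < p) (K : ℕ) {n : ℕ} (hn : 0 < n) :
    Real.exp (-(K * -Real.log p + 2) * n) ≤ p ^ (K * n) / (2 * n) := by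
  have hn' : (0 : ℝ) < n := by exact_mod_cast hn
  have h1 : p ^ (K * n) = Real.exp (K * n * Real.log p) := by
    rw [← Nat.cast_mul, Real.exp_nat_mul, Real.exp_log hp]
  have h2 : 2 * (n : ℝ) ≤ Real.exp (2 * n) := by linarith [Real.add_one_le_exp (2 * (n : ℝ))]
  rw [le_div_iff₀ (by positivity), h1]
  calc _ ≤ Real.exp (-(K * -Real.log p + 2) * n) * Real.exp (2 * n) := by gcongr
    _ = _ := by
      rw [← Real.exp_add]
      congr 1
      ring

theorem card_tower_le_exp {m : ℕ} [NeZero m] {r j : ℕ} (hr : 1 ≤ r) (hj : r ≤ j) :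
    ((tower m (2 * j + 2 * r) (2 * j)).card : ℝ) ≤ Real.exp ((9 * Real.log m + 4) * j) := by
  have hm : 1 ≤ m := NeZero.one_le
  have hm' : (0 : ℝ) < m := by exact_mod_cast hm
  have h1 : m ^ (2 * (2 * j + 2 * r) + 1) ≤ m ^ (9 * j) := Nat.pow_le_pow_right hm (by omega)
  have h2 : (m : ℝ) ^ (9 * j) = Real.exp (9 * Real.log m * j) := by
    rw [← Real.exp_log hm', ← Real.exp_nat_mul, Real.log_exp]
    push_cast
    ring_nf
  have h3 : 4 * (j : ℝ) + 1 ≤ Real.exp (4 * j) := Real.add_one_le_exp _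
  rw [card_tower, add_mul, Real.exp_add, ← h2]
  push_cast
  refine mul_le_mul (by exact_mod_cast h1) (by linarith) (by positivity) (by positivity)

/-- Tent functions of height `j ≈ E^{-1/2}` live on sets of exponential size in `j`, whence the
doubly exponential lower bound. -/
theorem exists_le_ids_dirichlet {m : ℕ} [NeZero m] {S : Finset (Lamplighter m)}
    (hS : IsCayleyGenerators S) (M : Model) {p : unitInterval} (hp : 0 < p) :
    ∃ c₁ > (0 : ℝ), ∃ c₂ > (0 : ℝ), ∀ E : ℝ, 0 < E → E ≤ 1 →
      Real.exp (-c₁ * Real.exp (c₂ * E ^ (-(1 / 2) : ℝ))) ≤ ids S M p .dirichlet E := by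
  obtain ⟨r, hr, hSr⟩ := exists_reach S
  have hS0 := nonempty_of_isCayleyGenerators hS
  have hr' : (1 : ℝ) ≤ r := by exact_mod_cast hr
  have hk : (1 : ℝ) ≤ S.card := by exact_mod_cast hS0.card_pos
  have hp' : (0 : ℝ) < p := hp
  have hlogp : 0 ≤ -Real.log p := neg_nonneg.2 (Real.log_nonpos p.2.1 p.2.2)
  have hm : (1 : ℝ) ≤ m := by exact_mod_cast (NeZero.one_le : 1 ≤ m)
  have hlogm : 0 ≤ Real.log m := Real.log_nonneg hm
  set a : ℝ := 7 * S.card * (r : ℝ) ^ 2 with ha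
  set c : ℝ := 9 * Real.log m + 4 with hc
  set d : ℝ := (S.card + 1 : ℕ) * -Real.log p + 2 with hd
  have har : (r : ℝ) ≤ a := by nlinarith
  have ha1 : 1 ≤ a := hr'.trans har
  have hc0 : 0 < c := by positivity
  have hd0 : 0 < d := by positivity
  refine ⟨d * Real.exp c, by positivity, c * a, by positivity, fun E hE hE1 => ?_⟩
  set y : ℝ := E ^ (-(1 / 2) : ℝ) with hy
  have hy1 : 1 ≤ y := Real.one_le_rpow_of_pos_of_le_one_of_nonpos hE hE1 (by norm_num)
  have hy2 : E * y ^ 2 = 1 := by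
    rw [hy, ← Real.rpow_natCast, ← Real.rpow_mul hE.le]
    norm_num
    rw [Real.rpow_neg_one, mul_inv_cancel₀ hE.ne']
  -- `E j² ≥ E (a y)² = a² ≥ a = 7 k r²`, the bound that the Rayleigh quotient requires.
  set j : ℕ := ⌈a * y⌉₊ with hj
  have hj1 : a * y ≤ j := Nat.le_ceil _
  have hj2 : (j : ℝ) ≤ a * y + 1 := (Nat.ceil_lt_add_one (by positivity)).le
  have hrj : r ≤ j := by
    have : (r : ℝ) ≤ j := by nlinarith
    exact_mod_cast this
  have hEj : 7 * S.card * (r : ℝ) ^ 2 ≤ E * (j : ℝ) ^ 2 := by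
    calc a ≤ a ^ 2 * (E * y ^ 2) := by rw [hy2]; nlinarith
      _ = E * (a * y) ^ 2 := by ring
      _ ≤ E * (j : ℝ) ^ 2 := by gcongr
  have hj0 : (0 : ℝ) < j := by
    have : 0 < j := by omega
    exact_mod_cast this
  have hcard : 0 < (tower m (2 * j + 2 * r) (2 * j)).card := by
    rw [card_tower]
    have : 0 < m := NeZero.pos m
    positivity
  have h0 : 0 < ∑ x ∈ tower m (2 * j + 2 * r) (2 * j),
      tent (2 * j + 2 * r) (2 * j) x ^ 2 :=
    lt_of_lt_of_le (by positivity) (pow_three_le_sum_tent_sq (m := m) (2 * j + 2 * r) j)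
  refine le_trans ?_ (le_ids_dirichlet hS hS0 M p (fun x hx => tent_eq_zero hx) hE h0
    (rayleigh_tent hr hSr hrj hEj))
  refine le_trans ?_ (exp_neg_le_pow_div hp' (S.card + 1) hcard)
  refine Real.exp_le_exp.2 ?_
  rw [← hd, neg_mul, neg_mul, neg_le_neg_iff, mul_assoc]
  refine mul_le_mul_of_nonneg_left ((card_tower_le_exp hr hrj).trans ?_) hd0.le
  rw [← hc, ← Real.exp_add]
  refine Real.exp_le_exp.2 ?_
  nlinarith

end Percolation

theorem theorem3p9 (m : ℕ) [NeZero m] :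
    Percolation.IsCayleyGenerators (Lamplighter.naturalGenerators m) ∧
    ∀ S : Finset (Lamplighter m), Percolation.IsCayleyGenerators S →
      ∀ (M : Percolation.Model) (p : unitInterval), 0 < p → p < 1 →
        ∃ c₁ > (0 : ℝ), ∃ c₂ > (0 : ℝ), ∀ᶠ E : ℝ in 𝓝[>] 0,
          Real.exp (-c₁ * Real.exp (c₂ * E ^ (-(1 / 2) : ℝ))) ≤
            Percolation.ids S M p .dirichlet E ∧
          Percolation.ids S M p .dirichlet E ≤ Percolation.ids S M p .adjacency E := by
  refine ⟨Lamplighter.isCayleyGenerators_naturalGenerators m, fun S hS M p hp _ => ?_⟩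
  obtain ⟨c₁, hc₁, c₂, hc₂, h⟩ := Percolation.exists_le_ids_dirichlet hS M hp
  refine ⟨c₁, hc₁, c₂, hc₂, ?_⟩
  filter_upwards [Ioc_mem_nhdsGT one_pos] with E hE
  exact ⟨h E hE.1 hE.2, Percolation.ids_dirichlet_le_adjacency M hS p E⟩
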